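/- **Conventions.** All manifolds, metrics and scalars are smooth. For a semi-Riemannian manifold of dimension $d$ with metric $g$ let $R$ be its curvature tensor, normalized so that $R=\frac c2\,g\wedge g$ for constant sectional curvature $c$, let $S_{jk}=g^{il}R_{ijkl}$ be its Ricci tensor, $S^2_{ij}=g^{kl}S_{ik}S_{jl}$ and $\kappa=\mathrm{tr}(S)$ its scalar curvature, where $\mathrm{tr}(A)=g^{ij}A_{ij}$. For $(0,2)$ tensors, $(A\wedge E)_{ijkl}=A_{il}E_{jk}+A_{jk}E_{il}-A_{ik}E_{jl}-A_{jl}E_{ik}$. The manifold is *generalized Roter type* if $R$ is a linear combination, with scalars as coefficients, of $g\wedge g$, $g\wedge S$, $S\wedge S$, $g\wedge S^2$, $S\wedge S^2$, $S^2\wedge S^2$; *Roter type* if $R$ is such a combination of $g\wedge g$, $g\wedge S$, $S\wedge S$; *conformally flat* if $R$ is such a combination of $g\wedge g$, $g\wedge S$ (for $d\ge 3$ this is the vanishing of $C=R-\frac1{d-2}g\wedge S+\frac{\kappa}{2(d-1)(d-2)}g\wedge g$); *of constant curvature* if $R=\frac c2\,g\wedge g$ with a real constant $c$; *Einstein* if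 $S=\frac{\kappa}{d}g$; $Ein(2)$ if $S^2,S,g$ satisfy a linear relation whose coefficients are scalars without common zero. **Statement.** Let $(\overline M,\overline g)$ and $(\widetilde M,\widetilde g)$ be connected semi-Riemannian manifolds of dimensions $p\ge1$ and $m=n-p\ge 1$, let $f>0$ be a smooth function on $\overline M$, and let $M=\overline M\times_f\widetilde M$ be the warped product, i.e. $\overline M\times\widetilde M$ with the metric $g=\pi^*\overline g+(f\circ\pi)\,\sigma^*\widetilde g$ ($\pi,\sigma$ the projections). Bars and tildes denote quantities of the base and of the fiber. Put $f_a=\partial_af$ and, on $\overline M$, $$T_{ab}=-\tfrac1{2f}\Big(\overline\nabla_bf_a-\tfrac1{2f}f_af_b\Big),\quad P=\tfrac1{4f^2}\overline g^{ab}f_af_b,\quad Q=f\big(\mathrm{tr}(T)-(m-1)P\big),$$ $T^2_{ab}=\overline g^{cd}T_{ac}T_{db}$, $(\overline S\cdot T)_{ab}=\overline g^{cd}(\overline S_{ac}T_{db}+T_{ac}\overline S_{db})$, $\overline r=\mathrm{tr}(\overline S)$, $\overline{r^{(2)}}=\mathrm{tr}(\overline S^2)$ and $\Theta=m\big(m\,\mathrm{tr}(T^2)+\mathrm{tr}(\overline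 S\cdot T)\big)+\overline{r^{(2)}}$. Suppose that, with scalars $L_1,\dots,L_6$ on $M$, $$R=L_1\,g\wedge g+L_2\,g\wedge S+L_3\,S\wedge S+L_4\,g\wedge S^2+L_5\,S\wedge S^2+L_6\,S^2\wedge S^2,$$ and define on $M$ $$J_1=-\frac{L_5\overline r+2L_6\Theta+L_4p+L_5\,m\,\mathrm{tr}(T)}{f},$$ $$J_2=-\frac1f\Big[2\overline r(fL_3+L_5Q)+(fL_5+4L_6Q)\Theta+p(fL_2+2L_4Q)+2m\,\mathrm{tr}(T)(fL_3+L_5Q)\Big].$$ Then: (i) The fiber $\widetilde M$ is generalized Roter type. (ii) If for some $x\in\overline M$ the function $J_1$ vanishes nowhere on $\{x\}\times\widetilde M$ (in particular, if $J_1$ vanishes nowhere on $M$), then $\widetilde M$ is Roter type and satisfies $Ein(2)$. (iii) If for some $x\in\overline M$, everywhere on $\{x\}\times\widetilde M$, $J_1\neq0$ and $$\frac{J_2^2L_6}{f^2J_1^2}-\frac{J_2(fL_5+4L_6Q)}{f^2J_1}+\frac{2Q(fL_5+2L_6Q)}{f^2}+L_3=0,$$ then $\widetilde M$ is conformally flat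 (and $\widetilde C=0$ if $m\ge 3$). (iv) If for some $x\in\overline M$, everywhere on $\{x\}\times\widetilde M$, $J_1=0$ and $J_2\ne0$, then $\widetilde R=\frac{\mu}2\,\widetilde g\wedge\widetilde g$ for a scalar $\mu$ on $\widetilde M$ and $\widetilde M$ is Einstein; if moreover $m\neq2$, then $\widetilde M$ is of constant curvature. (v) If there are scalars $\alpha,\beta,\gamma$ on $\overline M$, $\alpha$ nowhere zero, with $\alpha T+\beta\overline g+\gamma\overline S=0$, then the base $\overline M$ is generalized Roter type. -/

import Mathlib

open scoped Manifold ContDiff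
open Module

noncomputable section

namespace WarpedGRT

/-! ### Tensor calculus in one coordinate domain

`E` is the coordinate space and `b` the basis of coordinate directions `∂ᵢ`.  A semi-Riemannian
metric is given by its component matrix `g : E → Matrix ι ι ℝ`. -/

section Coordinates

variable {ι E : Type*} [Fintype ι] [DecidableEq ι] [NormedAddCommGroup E] [NormedSpace ℝ E]

/-- The partial derivative `∂ᵢ u`. -/
def pd (b : Basis ι ℝ E) (i : ι) (u : E → ℝ) (z : E) : ℝ := fderiv ℝ u z (b i)

/-- Christoffel symbols
`Γˡᵢⱼ = ½ gˡᵏ (∂ᵢ gₖⱼ + ∂ⱼ gₖᵢ - ∂ₖ gᵢⱼ)` of the Levi-Civita connection. -/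
def christoffel (b : Basis ι ℝ E) (g : E → Matrix ι ι ℝ) (l i j : ι) (z : E) : ℝ :=
  (1 / 2) * ∑ k, (g z)⁻¹ l k *
    (pd b i (fun w => g w k j) z + pd b j (fun w => g w k i) z - pd b k (fun w => g w i j) z)

/-- The curvature tensor
`R_{hijk} = g_{hl} (∂ₖ Γˡᵢⱼ - ∂ⱼ Γˡᵢₖ + Γᵐᵢⱼ Γˡₘₖ - Γᵐᵢₖ Γˡₘⱼ)`. -/
def riem (b : Basis ι ℝ E) (g : E → Matrix ι ι ℝ) (z : E) (h i j k : ι) : ℝ :=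
  ∑ l, g z h l *
    (pd b k (christoffel b g l i j) z - pd b j (christoffel b g l i k) z
      + ∑ m, (christoffel b g m i j z * christoffel b g l m k z
          - christoffel b g m i k z * christoffel b g l m j z))

/-- The Ricci tensor `S_{jk} = g^{il} R_{ijkl}`. -/
def ricci (b : Basis ι ℝ E) (g : E → Matrix ι ι ℝ) (z : E) : Matrix ι ι ℝ :=
  Matrix.of fun j k => ∑ i, ∑ l, (g z)⁻¹ i l * riem b g z i j k l

/-- The second covariant derivative `∇_c u_a = ∂_c ∂_a u - Γᵈ_{ac} ∂_d u` of a function `u`. -/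
def hess (b : Basis ι ℝ E) (g : E → Matrix ι ι ℝ) (u : E → ℝ) (z : E) : Matrix ι ι ℝ :=
  Matrix.of fun a c => pd b c (pd b a u) z - ∑ d, christoffel b g d a c z * pd b d u z

/-- The tensor `T_{ac} = -(1/2f) (∇_c f_a - (1/2f) f_a f_c)`. -/
def tensorT (b : Basis ι ℝ E) (g : E → Matrix ι ι ℝ) (f : E → ℝ) (z : E) : Matrix ι ι ℝ :=
  Matrix.of fun a c =>
    -(1 / (2 * f z)) * (hess b g f z a c - 1 / (2 * f z) * (pd b a f z * pd b c f z))

/-- The scalar `P = (1/4f²) g^{ac} f_a f_c`. -/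
def scalarP (b : Basis ι ℝ E) (g : E → Matrix ι ι ℝ) (f : E → ℝ) (z : E) : ℝ :=
  1 / (4 * f z ^ 2) * ∑ a, ∑ c, (g z)⁻¹ a c * (pd b a f z * pd b c f z)

end Coordinates

/-! ### Algebra of (0,2) tensors at a point, `g` being the matrix of the metric -/

section Algebra

variable {ι : Type*} [Fintype ι] [DecidableEq ι]

/-- The metric trace `g^{ij} A_{ij}`. -/
def tr (g A : Matrix ι ι ℝ) : ℝ := ∑ i, ∑ j, g⁻¹ i j * A i j

/-- The product `g^{kl} A_{ik} B_{lj}` of (0,2) tensors (composition of the associated operators);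
`comp g S S` is the Ricci tensor of level 2. -/
def comp (g A B : Matrix ι ι ℝ) : Matrix ι ι ℝ :=
  Matrix.of fun i j => ∑ k, ∑ l, g⁻¹ k l * (A i k * B l j)

/-- The symmetric product `A · B`, with components `g^{kl} (A_{ik} B_{lj} + B_{ik} A_{lj})`. -/
def symProd (g A B : Matrix ι ι ℝ) : Matrix ι ι ℝ := comp g A B + comp g B A

/-- The Kulkarni–Nomizu product `A ∧ B`. -/
def kn (A B : Matrix ι ι ℝ) (i j k l : ι) : ℝ :=
  A i l * B j k + A j k * B i l - A i k * B j l - A j l * B i k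

end Algebra

/-! ### Semi-Riemannian manifolds

A field of bilinear forms `g` on the tangent spaces of a manifold `M` is read in the charts of the
atlas of `M`.  A tensor identity on `M` is expressed by the identity of the components
in all charts of the atlas. -/

section Manifold

variable {ι E H M : Type*} [Fintype ι] [DecidableEq ι] [NormedAddCommGroup E] [NormedSpace ℝ E]
  [TopologicalSpace H] [TopologicalSpace M] [ChartedSpace H M]

/-- Fields of bilinear forms on the tangent spaces of `M`. -/
abbrev FormField (I : ModelWithCorners ℝ E H) (M : Type*) [TopologicalSpace M]
    [ChartedSpace H M] : Type _ :=
  ∀ q : M, LinearMap.BilinForm ℝ (TangentSpace I q)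

/-- The coordinate vector `∂ᵢ` of the chart `e`, at the point with coordinates `z`. -/
def coordVec (I : ModelWithCorners ℝ E H) (b : Basis ι ℝ E) (e : OpenPartialHomeomorph M H)
    (z : E) (i : ι) : TangentSpace I ((e.extend I).symm z) :=
  mfderiv 𝓘(ℝ, E) I (e.extend I).symm z (b i)

/-- The components `g_{ij} = g(∂ᵢ, ∂ⱼ)` in the chart `e`, as functions of the coordinates. -/
def metricCoord (I : ModelWithCorners ℝ E H) (b : Basis ι ℝ E) (g : FormField I M)
    (e : OpenPartialHomeomorph M H) (z : E) : Matrix ι ι ℝ :=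
  Matrix.of fun i j => g ((e.extend I).symm z) (coordVec I b e z i) (coordVec I b e z j)

/-- `g` is a smooth semi-Riemannian metric: symmetric, nondegenerate, with smooth components. -/
structure IsSemiRiemannian (I : ModelWithCorners ℝ E H) (b : Basis ι ℝ E) (g : FormField I M) :
    Prop where
  symm : ∀ (q : M) (u v : TangentSpace I q), g q u v = g q v u
  nondegenerate : ∀ (q : M) (u : TangentSpace I q), (∀ v : TangentSpace I q, g q u v = 0) → u = 0
  smooth : ∀ e ∈ atlas H M, ∀ i j : ι,
    ContDiffOn ℝ ∞ (fun z => metricCoord I b g e z i j) (e.extend I).target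

/-- Components of the metric in the chart `e` at the point `q`. -/
def gAt (I : ModelWithCorners ℝ E H) (b : Basis ι ℝ E) (g : FormField I M)
    (e : OpenPartialHomeomorph M H) (q : M) : Matrix ι ι ℝ :=
  metricCoord I b g e (e.extend I q)

/-- Components of the curvature tensor `R` in the chart `e` at the point `q`. -/
def rAt (I : ModelWithCorners ℝ E H) (b : Basis ι ℝ E) (g : FormField I M)
    (e : OpenPartialHomeomorph M H) (q : M) : ι → ι → ι → ι → ℝ :=
  riem b (metricCoord I b g e) (e.extend I q)

/-- Components of the Ricci tensor `S` in the chart `e` at the point `q`. -/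
def sAt (I : ModelWithCorners ℝ E H) (b : Basis ι ℝ E) (g : FormField I M)
    (e : OpenPartialHomeomorph M H) (q : M) : Matrix ι ι ℝ :=
  ricci b (metricCoord I b g e) (e.extend I q)

/-- Components of the Ricci tensor of level two `S²` in the chart `e` at the point `q`. -/
def s2At (I : ModelWithCorners ℝ E H) (b : Basis ι ℝ E) (g : FormField I M)
    (e : OpenPartialHomeomorph M H) (q : M) : Matrix ι ι ℝ :=
  comp (gAt I b g e q) (sAt I b g e q) (sAt I b g e q)

/-- The scalar curvature `κ`, computed in the chart `e` at the point `q`. -/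
def scalAt (I : ModelWithCorners ℝ E H) (b : Basis ι ℝ E) (g : FormField I M)
    (e : OpenPartialHomeomorph M H) (q : M) : ℝ :=
  tr (gAt I b g e q) (sAt I b g e q)

/-- The generalized Roter type condition with given associated scalars:
`R = L₁ g∧g + L₂ g∧S + L₃ S∧S + L₄ g∧S² + L₅ S∧S² + L₆ S²∧S²`. -/
def IsGRTWith (I : ModelWithCorners ℝ E H) (b : Basis ι ℝ E) (g : FormField I M)
    (L₁ L₂ L₃ L₄ L₅ L₆ : M → ℝ) : Prop :=
  ∀ e ∈ atlas H M, ∀ q ∈ e.source, ∀ i j k l : ι,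
    rAt I b g e q i j k l =
      L₁ q * kn (gAt I b g e q) (gAt I b g e q) i j k l
      + L₂ q * kn (gAt I b g e q) (sAt I b g e q) i j k l
      + L₃ q * kn (sAt I b g e q) (sAt I b g e q) i j k l
      + L₄ q * kn (gAt I b g e q) (s2At I b g e q) i j k l
      + L₅ q * kn (sAt I b g e q) (s2At I b g e q) i j k l
      + L₆ q * kn (s2At I b g e q) (s2At I b g e q) i j k l

/-- Smooth scalars on `M`. -/
def IsScalar (I : ModelWithCorners ℝ E H) (u : M → ℝ) : Prop := ContMDiff I 𝓘(ℝ, ℝ) ∞ u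

/-- Generalized Roter type manifolds. -/
def IsGRT (I : ModelWithCorners ℝ E H) (b : Basis ι ℝ E) (g : FormField I M) : Prop :=
  ∃ L₁ L₂ L₃ L₄ L₅ L₆ : M → ℝ,
    (IsScalar I L₁ ∧ IsScalar I L₂ ∧ IsScalar I L₃ ∧ IsScalar I L₄ ∧ IsScalar I L₅ ∧
      IsScalar I L₆) ∧ IsGRTWith I b g L₁ L₂ L₃ L₄ L₅ L₆

/-- Roter type manifolds: `R = N₁ g∧g + N₂ g∧S + N₃ S∧S`. -/
def IsRoter (I : ModelWithCorners ℝ E H) (b : Basis ι ℝ E) (g : FormField I M) : Prop :=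
  ∃ N₁ N₂ N₃ : M → ℝ, (IsScalar I N₁ ∧ IsScalar I N₂ ∧ IsScalar I N₃) ∧
    ∀ e ∈ atlas H M, ∀ q ∈ e.source, ∀ i j k l : ι,
      rAt I b g e q i j k l =
        N₁ q * kn (gAt I b g e q) (gAt I b g e q) i j k l
        + N₂ q * kn (gAt I b g e q) (sAt I b g e q) i j k l
        + N₃ q * kn (sAt I b g e q) (sAt I b g e q) i j k l

/-- Conformally flat manifolds, in the sense that `R = N₁ g∧g + N₂ g∧S`. -/
def IsConformallyFlat (I : ModelWithCorners ℝ E H) (b : Basis ι ℝ E) (g : FormField I M) : Prop :=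
  ∃ N₁ N₂ : M → ℝ, (IsScalar I N₁ ∧ IsScalar I N₂) ∧
    ∀ e ∈ atlas H M, ∀ q ∈ e.source, ∀ i j k l : ι,
      rAt I b g e q i j k l =
        N₁ q * kn (gAt I b g e q) (gAt I b g e q) i j k l
        + N₂ q * kn (gAt I b g e q) (sAt I b g e q) i j k l

/-- Vanishing of the conformal curvature tensor
`C = R - (1/(d-2)) g∧S + (κ/(2(d-1)(d-2))) g∧g`; here `d` is the dimension, and the condition is
meaningful for `d ≥ 3`. -/
def WeylVanishes (I : ModelWithCorners ℝ E H) (b : Basis ι ℝ E) (g : FormField I M) : Prop :=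
  ∀ e ∈ atlas H M, ∀ q ∈ e.source, ∀ i j k l : ι,
    rAt I b g e q i j k l
      - 1 / ((Fintype.card ι : ℝ) - 2) * kn (gAt I b g e q) (sAt I b g e q) i j k l
      + scalAt I b g e q / (2 * ((Fintype.card ι : ℝ) - 1) * ((Fintype.card ι : ℝ) - 2))
        * kn (gAt I b g e q) (gAt I b g e q) i j k l = 0

/-- At each point all sectional curvatures coincide: `R = μ G` with a scalar `μ` and the Gaussian
curvature tensor `G = ½ g∧g`. -/
def HasPointwiseConstantCurvature (I : ModelWithCorners ℝ E H) (b : Basis ι ℝ E)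
    (g : FormField I M) : Prop :=
  ∃ μ : M → ℝ, IsScalar I μ ∧ ∀ e ∈ atlas H M, ∀ q ∈ e.source, ∀ i j k l : ι,
    rAt I b g e q i j k l = μ q * (1 / 2 * kn (gAt I b g e q) (gAt I b g e q) i j k l)

/-- Constant curvature: `R = c G` with a real constant `c`. -/
def HasConstantCurvature (I : ModelWithCorners ℝ E H) (b : Basis ι ℝ E)
    (g : FormField I M) : Prop :=
  ∃ c : ℝ, ∀ e ∈ atlas H M, ∀ q ∈ e.source, ∀ i j k l : ι,
    rAt I b g e q i j k l = c * (1 / 2 * kn (gAt I b g e q) (gAt I b g e q) i j k l)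

/-- Einstein manifolds: `S = (κ/d) g`, where `d` is the dimension. -/
def IsEinstein (I : ModelWithCorners ℝ E H) (b : Basis ι ℝ E) (g : FormField I M) : Prop :=
  ∀ e ∈ atlas H M, ∀ q ∈ e.source,
    sAt I b g e q = (scalAt I b g e q / (Fintype.card ι : ℝ)) • gAt I b g e q

/-- The `Ein(2)` condition: `S²`, `S`, `g` are linearly dependent, that is, they satisfy a linear
relation whose coefficients are scalars without common zero. -/
def IsEin2 (I : ModelWithCorners ℝ E H) (b : Basis ι ℝ E) (g : FormField I M) : Prop :=
  ∃ α β γ : M → ℝ, (IsScalar I α ∧ IsScalar I β ∧ IsScalar I γ) ∧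
    (∀ q, α q ≠ 0 ∨ β q ≠ 0 ∨ γ q ≠ 0) ∧
    ∀ e ∈ atlas H M, ∀ q ∈ e.source,
      α q • s2At I b g e q + β q • sAt I b g e q + γ q • gAt I b g e q = 0

/-- Components of `T` (for the function `f` on `M`) in the chart `e` at the point `q`. -/
def tAt (I : ModelWithCorners ℝ E H) (b : Basis ι ℝ E) (g : FormField I M) (f : M → ℝ)
    (e : OpenPartialHomeomorph M H) (q : M) : Matrix ι ι ℝ :=
  tensorT b (metricCoord I b g e) (f ∘ (e.extend I).symm) (e.extend I q)

/-- The scalar `P` (for the function `f` on `M`), computed in the chart `e` at the point `q`. -/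
def pAt (I : ModelWithCorners ℝ E H) (b : Basis ι ℝ E) (g : FormField I M) (f : M → ℝ)
    (e : OpenPartialHomeomorph M H) (q : M) : ℝ :=
  scalarP b (metricCoord I b g e) (f ∘ (e.extend I).symm) (e.extend I q)

/-- `T`, `g`, `S` are linearly dependent with nowhere zero coefficient of `T`. -/
def DependentT (I : ModelWithCorners ℝ E H) (b : Basis ι ℝ E) (g : FormField I M) (f : M → ℝ) :
    Prop :=
  ∃ α β γ : M → ℝ, (IsScalar I α ∧ IsScalar I β ∧ IsScalar I γ) ∧ (∀ q, α q ≠ 0) ∧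
    ∀ e ∈ atlas H M, ∀ q ∈ e.source,
      α q • tAt I b g f e q + β q • gAt I b g e q + γ q • sAt I b g e q = 0

end Manifold

/-! ### Warped products -/

section Warped

variable {ι E H B : Type*} [Fintype ι] [DecidableEq ι] [NormedAddCommGroup E] [NormedSpace ℝ E]
  [TopologicalSpace H] [TopologicalSpace B] [ChartedSpace H B]
  {E' H' F : Type*} [NormedAddCommGroup E'] [NormedSpace ℝ E']
  [TopologicalSpace H'] [TopologicalSpace F] [ChartedSpace H' F]

/-- The pull-back of a field of bilinear forms under a map. -/
def pullback (I : ModelWithCorners ℝ E H) (I' : ModelWithCorners ℝ E' H') (φ : B → F)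
    (g : FormField I' F) : FormField I B :=
  fun q => (g (φ q)).comp (mfderiv I I' φ q).toLinearMap (mfderiv I I' φ q).toLinearMap

/-- The warped product metric `π^* gB + (f ∘ π) σ^* gF` on `B × F`. -/
def warpedMetric (I : ModelWithCorners ℝ E H) (I' : ModelWithCorners ℝ E' H')
    (gB : FormField I B) (gF : FormField I' F) (f : B → ℝ) : FormField (I.prod I') (B × F) :=
  fun q => pullback (I.prod I') I Prod.fst gB q
    + f q.1 • pullback (I.prod I') I' Prod.snd gF q

/-- The trace of `T` at a point of the base. -/
def trT (I : ModelWithCorners ℝ E H) (b : Basis ι ℝ E) (g : FormField I B) (f : B → ℝ)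
    (x : B) : ℝ :=
  tr (gAt I b g (chartAt H x) x) (tAt I b g f (chartAt H x) x)

/-- The scalar `Q = f (tr T - (m - 1) P)` on the base, `m` being the dimension of the fiber; it is
the scalar for which the fiber part of the Ricci tensor of the warped product is the Ricci tensor
of the fiber plus `Q` times the metric of the fiber. -/
def scalarQ (I : ModelWithCorners ℝ E H) (b : Basis ι ℝ E) (g : FormField I B) (f : B → ℝ)
    (m : ℕ) (x : B) : ℝ :=
  f x * (trT I b g f x - ((m : ℝ) - 1) * pAt I b g f (chartAt H x) x)

/-- The scalar curvature `r` of the base. -/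
def rBase (I : ModelWithCorners ℝ E H) (b : Basis ι ℝ E) (g : FormField I B) (x : B) : ℝ :=
  scalAt I b g (chartAt H x) x

/-- The bracket `m (m tr(T²) + tr(S·T)) + r⁽²⁾` at a point of the base, where `r⁽²⁾ = tr(S²)`. -/
def bracketBase (I : ModelWithCorners ℝ E H) (b : Basis ι ℝ E) (g : FormField I B) (f : B → ℝ)
    (m : ℕ) (x : B) : ℝ :=
  (m : ℝ) * ((m : ℝ) * tr (gAt I b g (chartAt H x) x)
          (comp (gAt I b g (chartAt H x) x) (tAt I b g f (chartAt H x) x)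
            (tAt I b g f (chartAt H x) x))
      + tr (gAt I b g (chartAt H x) x)
          (symProd (gAt I b g (chartAt H x) x) (sAt I b g (chartAt H x) x)
            (tAt I b g f (chartAt H x) x)))
    + tr (gAt I b g (chartAt H x) x) (s2At I b g (chartAt H x) x)

/-- The scalar `J₁` on the warped product. -/
def J1 (I : ModelWithCorners ℝ E H) (b : Basis ι ℝ E) (g : FormField I B) (f : B → ℝ) (m : ℕ)
    (L₄ L₅ L₆ : B × F → ℝ) (q : B × F) : ℝ :=
  -((L₅ q * rBase I b g q.1 + 2 * L₆ q * bracketBase I b g f m q.1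
      + L₄ q * (Fintype.card ι : ℝ) + L₅ q * trT I b g f q.1 * (m : ℝ)) / f q.1)

/-- The scalar `J₂` on the warped product. -/
def J2 (I : ModelWithCorners ℝ E H) (b : Basis ι ℝ E) (g : FormField I B) (f : B → ℝ) (m : ℕ)
    (L₂ L₃ L₄ L₅ L₆ : B × F → ℝ) (q : B × F) : ℝ :=
  -(1 / f q.1) *
    (2 * rBase I b g q.1 * (f q.1 * L₃ q + L₅ q * scalarQ I b g f m q.1)
      + (f q.1 * L₅ q + 4 * L₆ q * scalarQ I b g f m q.1) * bracketBase I b g f m q.1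
      + (Fintype.card ι : ℝ) * (f q.1 * L₂ q + 2 * L₄ q * scalarQ I b g f m q.1)
      + 2 * trT I b g f q.1 * (m : ℝ) * (f q.1 * L₃ q + L₅ q * scalarQ I b g f m q.1))

end Warped

/-- The standard basis of `ℝᵈ`. -/
abbrev stdBasis (d : ℕ) : Basis (Fin d) ℝ (EuclideanSpace ℝ (Fin d)) :=
  (EuclideanSpace.basisFun (Fin d) ℝ).toBasis

end WarpedGRT

end

noncomputable section

namespace WarpedGRT

/-! ### Local theory of a semi-Riemannian metric in coordinates -/

section PartialDerivatives

variable {ι E : Type*} [NormedAddCommGroup E] [NormedSpace ℝ E]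

/-! In product charts the warped metric, its Ricci tensor and hence the tensor of level two are
block diagonal. The Ricci blocks are `S̄ + m T` on the base and `S̃ + Q g̃` on the fiber. The
curvature components needed are `R̄` (all indices on the base), `f T_{ad} g̃_{βγ}` (indices `aβγd`)
and `f R̃ - f² P · ½ g̃∧g̃` (all indices on the fiber). The generalized Roter identity is therefore
read block by block.

The fiber block expresses `R̃` through Kulkarni–Nomizu products of `g̃`, `X = S̃ + Q g̃` and `X²`.
Since `X` is affine in `S̃`, expansion gives the generalized Roter form of `R̃` (`isGRTAt_fiber`).
Fixing `x` in the base makes the coefficients smooth functions on the fiber.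

In the `aβγd` block a product of block diagonal tensors reduces to `A_{ad} E_{βγ} + A_{βγ} E_{ad}`.
Tracing over the base indices turns the identity into `J₁ S̃² + J₂ S̃ + K g̃ = 0` along `{x} × F`
(`fiber_relation`, `fiber_structure`). Assertions (ii)-(iv) follow from it. If `J₁` has no zero,
`S̃²` is eliminated and `R̃` becomes Roter, with coefficient of `S̃∧S̃` equal to `1/f` times the
expression in (iii). If `J₁ = 0` and `J₂ ≠ 0`, then `S̃ = λ g̃`, so `R̃` is a multiple of `g̃∧g̃`,
and Schur's lemma makes the factor constant when `m ≥ 3`.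

The base block expresses `R̄` through `S̄ + m T`. A dependence of `T`, `ḡ`, `S̄` makes this tensor
affine in `S̄`, and the same expansion gives (v) (`isGRTAt_base`). -/

theorem contDiffOn_pd (b : Basis ι ℝ E) {s : Set E} (hs : IsOpen s) {u : E → ℝ}
    (hu : ContDiffOn ℝ ∞ u s) (i : ι) : ContDiffOn ℝ ∞ (pd b i u) s :=
  (hu.fderiv_of_isOpen hs (by simp)).clm_apply contDiffOn_const

theorem differentiableAt_of_contDiffOn {s : Set E} (hs : IsOpen s) {u : E → ℝ}
    (hu : ContDiffOn ℝ ∞ u s) {z : E} (hz : z ∈ s) : DifferentiableAt ℝ u z :=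
  (hu.contDiffAt (hs.mem_nhds hz)).differentiableAt (by simp)

theorem pd_congr_of_eventuallyEq (b : Basis ι ℝ E) {u v : E → ℝ} {z : E} (h : u =ᶠ[nhds z] v)
    (i : ι) : pd b i u z = pd b i v z := by
  simp only [pd, h.fderiv_eq]

theorem pd_congr (b : Basis ι ℝ E) {s : Set E} (hs : IsOpen s) {u v : E → ℝ} {z : E}
    (h : ∀ w ∈ s, u w = v w) (hz : z ∈ s) (i : ι) : pd b i u z = pd b i v z :=
  pd_congr_of_eventuallyEq b (Filter.eventuallyEq_of_mem (hs.mem_nhds hz) h) i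

theorem pd_const (b : Basis ι ℝ E) (c : ℝ) (i : ι) (z : E) : pd b i (fun _ => c) z = 0 := by
  simp [pd]

theorem pd_add (b : Basis ι ℝ E) {u v : E → ℝ} {z : E} (hu : DifferentiableAt ℝ u z)
    (hv : DifferentiableAt ℝ v z) (i : ι) :
    pd b i (fun w => u w + v w) z = pd b i u z + pd b i v z := by
  simp [pd, fderiv_fun_add hu hv]

theorem pd_sub (b : Basis ι ℝ E) {u v : E → ℝ} {z : E} (hu : DifferentiableAt ℝ u z)
    (hv : DifferentiableAt ℝ v z) (i : ι) :
    pd b i (fun w => u w - v w) z = pd b i u z - pd b i v z := by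
  simp [pd, fderiv_fun_sub hu hv]

theorem pd_mul (b : Basis ι ℝ E) {u v : E → ℝ} {z : E} (hu : DifferentiableAt ℝ u z)
    (hv : DifferentiableAt ℝ v z) (i : ι) :
    pd b i (fun w => u w * v w) z = pd b i u z * v z + u z * pd b i v z := by
  simp [pd, fderiv_fun_mul hu hv]; ring

theorem pd_sum (b : Basis ι ℝ E) {κ : Type*} [Fintype κ] {u : κ → E → ℝ} {z : E}
    (hu : ∀ k, DifferentiableAt ℝ (u k) z) (i : ι) :
    pd b i (fun w => ∑ k, u k w) z = ∑ k, pd b i (u k) z := by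
  simp [pd, fderiv_fun_sum fun k _ => hu k]

theorem pd_comm (b : Basis ι ℝ E) {s : Set E} (hs : IsOpen s) {u : E → ℝ}
    (hu : ContDiffOn ℝ ∞ u s) {z : E} (hz : z ∈ s) (i j : ι) :
    pd b i (pd b j u) z = pd b j (pd b i u) z := by
  have hd : DifferentiableAt ℝ (fderiv ℝ u) z :=
    ((hu.fderiv_of_isOpen (m := ∞) hs (by simp)).contDiffAt
      (hs.mem_nhds hz)).differentiableAt (by simp)
  have key : ∀ i j, pd b i (pd b j u) z = fderiv ℝ (fderiv ℝ u) z (b i) (b j) := by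
    intro i j
    have := (hd.hasFDerivAt.clm_apply (hasFDerivAt_const (b j) z)).fderiv
    change fderiv ℝ (fun w => fderiv ℝ u w (b j)) z (b i) = _
    rw [this]; simp
  rw [key, key]
  exact ((hu.contDiffAt (hs.mem_nhds hz)).isSymmSndFDerivAt
    (by simpa using WithTop.coe_le_coe.2 (le_top : (2 : ℕ∞) ≤ ⊤))) _ _

end PartialDerivatives

section LocalTheory

variable {ι E : Type*} [Fintype ι] [DecidableEq ι] [NormedAddCommGroup E] [NormedSpace ℝ E]

/-- A semi-Riemannian metric in coordinates ranging over the open set `s`. -/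
structure IsMetricOn (g : E → Matrix ι ι ℝ) (s : Set E) : Prop where
  isOpen : IsOpen s
  smooth : ∀ i j, ContDiffOn ℝ ∞ (fun z => g z i j) s
  symm : ∀ z ∈ s, ∀ i j, g z i j = g z j i
  isUnit : ∀ z ∈ s, IsUnit (g z).det

/-- The curvature tensor with its first index raised. -/
def curvOp (b : Basis ι ℝ E) (g : E → Matrix ι ι ℝ) (z : E) (l i j k : ι) : ℝ :=
  pd b k (christoffel b g l i j) z - pd b j (christoffel b g l i k) z
    + ∑ m, (christoffel b g m i j z * christoffel b g l m k z
        - christoffel b g m i k z * christoffel b g l m j z)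

theorem riem_eq_sum_curvOp (b : Basis ι ℝ E) (g : E → Matrix ι ι ℝ) (z : E) (h i j k : ι) :
    riem b g z h i j k = ∑ l, g z h l * curvOp b g z l i j k := rfl

namespace IsMetricOn

variable {g : E → Matrix ι ι ℝ} {s : Set E}

theorem inv_mul (h : IsMetricOn g s) {z : E} (hz : z ∈ s) (i j : ι) :
    ∑ k, (g z)⁻¹ i k * g z k j = if i = j then 1 else 0 := by
  have := congrFun (congrFun (Matrix.nonsing_inv_mul _ (h.isUnit z hz)) i) j
  simpa [Matrix.mul_apply, Matrix.one_apply] using this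

theorem inv_symm (h : IsMetricOn g s) {z : E} (hz : z ∈ s) (i j : ι) :
    (g z)⁻¹ i j = (g z)⁻¹ j i := by
  have h1 : (g z).transpose = g z := by ext i j; exact h.symm z hz j i
  have := Matrix.transpose_nonsing_inv (g z)
  rw [h1] at this
  exact congrFun (congrFun this j) i

theorem lower_raise (h : IsMetricOn g s) {z : E} (hz : z ∈ s) (D : ι → ℝ) (k : ι) :
    ∑ l, g z k l * ∑ n, (g z)⁻¹ l n * D n = D k := by
  change (g z).mulVec ((g z)⁻¹.mulVec D) k = D k
  rw [Matrix.mulVec_mulVec, Matrix.mul_nonsing_inv _ (h.isUnit z hz), Matrix.one_mulVec]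

theorem raise_lower (h : IsMetricOn g s) {z : E} (hz : z ∈ s) (D : ι → ℝ) (k : ι) :
    ∑ l, (g z)⁻¹ k l * ∑ n, g z l n * D n = D k := by
  change (g z)⁻¹.mulVec ((g z).mulVec D) k = D k
  rw [Matrix.mulVec_mulVec, Matrix.nonsing_inv_mul _ (h.isUnit z hz), Matrix.one_mulVec]

theorem differentiableAt (h : IsMetricOn g s) {z : E} (hz : z ∈ s) (i j : ι) :
    DifferentiableAt ℝ (fun w => g w i j) z :=
  differentiableAt_of_contDiffOn h.isOpen (h.smooth i j) hz

theorem smooth_inv (h : IsMetricOn g s) (i j : ι) :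
    ContDiffOn ℝ ∞ (fun z => (g z)⁻¹ i j) s := by
  have hdet : ContDiffOn ℝ ∞ (fun z => (g z).det) s := by
    simp only [Matrix.det_apply]
    exact ContDiffOn.sum fun σ _ => (contDiffOn_prod fun k _ => h.smooth _ _).const_smul _
  have hadj : ContDiffOn ℝ ∞ (fun z => (g z).adjugate i j) s := by
    simp only [Matrix.adjugate_apply, Matrix.det_apply]
    refine ContDiffOn.sum fun σ _ => (contDiffOn_prod fun k _ => ?_).const_smul _
    by_cases hk : σ k = j
    · simp only [hk, Matrix.updateRow_self]; exact contDiffOn_const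
    · simp only [Matrix.updateRow_ne hk]; exact h.smooth _ _
  have : ∀ z, (g z)⁻¹ i j = ((g z).det)⁻¹ * (g z).adjugate i j := by
    intro z; simp [Matrix.inv_def]
  simp only [this]
  exact (hdet.inv fun z hz => (h.isUnit z hz).ne_zero).mul hadj

theorem smooth_christoffel (h : IsMetricOn g s) (b : Basis ι ℝ E) (l i j : ι) :
    ContDiffOn ℝ ∞ (christoffel b g l i j) s := by
  unfold christoffel
  refine contDiffOn_const.mul (ContDiffOn.sum fun k _ => (h.smooth_inv l k).mul ?_)
  exact ((contDiffOn_pd b h.isOpen (h.smooth k j) i).add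
    (contDiffOn_pd b h.isOpen (h.smooth k i) j)).sub (contDiffOn_pd b h.isOpen (h.smooth i j) k)

theorem differentiableAt_christoffel (h : IsMetricOn g s) (b : Basis ι ℝ E) (l i j : ι) {z : E}
    (hz : z ∈ s) : DifferentiableAt ℝ (christoffel b g l i j) z :=
  differentiableAt_of_contDiffOn h.isOpen (h.smooth_christoffel b l i j) hz

theorem pd_symm (h : IsMetricOn g s) (b : Basis ι ℝ E) {z : E} (hz : z ∈ s) (i j k : ι) :
    pd b k (fun w => g w i j) z = pd b k (fun w => g w j i) z :=
  pd_congr b h.isOpen (fun w hw => h.symm w hw i j) hz k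

theorem christoffel_symm (h : IsMetricOn g s) (b : Basis ι ℝ E) {z : E} (hz : z ∈ s)
    (l i j : ι) : christoffel b g l i j z = christoffel b g l j i z := by
  unfold christoffel
  congr 1
  refine Finset.sum_congr rfl fun k _ => ?_
  rw [h.pd_symm b hz i j k]; ring

theorem sum_mul_christoffel (h : IsMetricOn g s) (b : Basis ι ℝ E) {z : E} (hz : z ∈ s)
    (k i j : ι) : ∑ l, g z k l * christoffel b g l i j z = 1 / 2 *
      (pd b i (fun w => g w k j) z + pd b j (fun w => g w k i) z
        - pd b k (fun w => g w i j) z) := by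
  rw [← h.lower_raise hz (fun k => pd b i (fun w => g w k j) z + pd b j (fun w => g w k i) z
        - pd b k (fun w => g w i j) z) k, Finset.mul_sum]
  refine Finset.sum_congr rfl fun l _ => ?_
  simp only [christoffel]; ring

/-- The Levi-Civita connection is metric. -/
theorem pd_metric (h : IsMetricOn g s) (b : Basis ι ℝ E) {z : E} (hz : z ∈ s) (k i j : ι) :
    pd b k (fun w => g w i j) z =
      ∑ l, g z i l * christoffel b g l j k z + ∑ l, g z j l * christoffel b g l i k z := by
  rw [h.sum_mul_christoffel b hz, h.sum_mul_christoffel b hz, h.pd_symm b hz j i k]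
  ring

theorem raise_riem (h : IsMetricOn g s) (b : Basis ι ℝ E) {z : E} (hz : z ∈ s) (l i j k : ι) :
    ∑ n, (g z)⁻¹ l n * riem b g z n i j k = curvOp b g z l i j k :=
  h.raise_lower hz (fun q => curvOp b g z q i j k) l

/-- With the first index raised, the Ricci tensor is a plain contraction of an expression in
Christoffel symbols. The inverse metric drops out, so each Ricci block of a warped product needs
only two blocks of `curvOp`. -/
theorem ricci_eq (h : IsMetricOn g s) (b : Basis ι ℝ E) {z : E} (hz : z ∈ s) (j k : ι) :
    ricci b g z j k = ∑ l, curvOp b g z l j k l := by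
  simp only [ricci, Matrix.of_apply]
  rw [Finset.sum_comm]
  refine Finset.sum_congr rfl fun l _ => ?_
  rw [← h.raise_riem b hz]
  exact Finset.sum_congr rfl fun i _ => by rw [h.inv_symm hz]

end IsMetricOn

end LocalTheory

/-! ### The second Bianchi identity and Schur's lemma -/

section Schur

theorem half_kn_self {ι : Type*} (A : Matrix ι ι ℝ) (i j k l : ι) :
    1 / 2 * kn A A i j k l = A i l * A j k - A i k * A j l := by
  simp only [kn]; ring

variable {ι E : Type*} [Fintype ι] [DecidableEq ι] [NormedAddCommGroup E] [NormedSpace ℝ E]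

variable {g : E → Matrix ι ι ℝ} {s : Set E}

/-- With connection matrices `A j`, the curvature is `W j k = ∂ₖ A j - ∂ⱼ A k + [A k, A j]`. The
identity is then a noncommutative polynomial identity once second derivatives commute. `B` keeps
only the connection terms acting on `q` and `i`: those acting on the cyclically permuted indices
cancel in the full covariant identity, by symmetry of `Γ`. -/
theorem IsMetricOn.second_bianchi (h : IsMetricOn g s) (b : Basis ι ℝ E) {z : E} (hz : z ∈ s)
    (q i n j k : ι) :
    let B := fun n j k : ι => pd b n (fun w => curvOp b g w q i j k) z
      + ∑ m, (christoffel b g q m n z * curvOp b g z m i j k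
        - curvOp b g z q m j k * christoffel b g m i n z)
    B n j k + B j k n + B k n j = 0 := by
  intro B
  let A : ι → Matrix ι ι ℝ := fun j => Matrix.of fun l i => christoffel b g l i j z
  let D : ι → ι → Matrix ι ι ℝ := fun k j => Matrix.of fun l i => pd b k (christoffel b g l i j) z
  let DD : ι → ι → ι → Matrix ι ι ℝ := fun n k j =>
    Matrix.of fun l i => pd b n (pd b k (christoffel b g l i j)) z
  have hDD : ∀ n k j, DD n k j = DD k n j := by
    intro n k j; ext l i
    exact pd_comm b h.isOpen (h.smooth_christoffel b l i j) hz n k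
  let W : ι → ι → Matrix ι ι ℝ := fun j k => D k j - D j k + A k * A j - A j * A k
  have hW : ∀ l i j k, curvOp b g z l i j k = W j k l i := by
    intro l i j k
    simp only [W, A, D, curvOp, Matrix.sub_apply, Matrix.add_apply, Matrix.mul_apply,
      Matrix.of_apply, Finset.sum_sub_distrib]
    simp only [mul_comm (christoffel b g _ i _ z)]
    ring
  have hdW : ∀ n j k, pd b n (fun w => curvOp b g w q i j k) z
      = (DD n k j - DD n j k + (D n k * A j + A k * D n j) - (D n j * A k + A j * D n k)) q i := by
    intro n j k
    have dΓ : ∀ l i j, DifferentiableAt ℝ (christoffel b g l i j) z := fun l i j =>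
      h.differentiableAt_christoffel b l i j hz
    have d1 : ∀ l i j k, DifferentiableAt ℝ (pd b k (christoffel b g l i j)) z := fun l i j k =>
      differentiableAt_of_contDiffOn h.isOpen
        (contDiffOn_pd b h.isOpen (h.smooth_christoffel b l i j) k) hz
    simp only [curvOp]
    rw [pd_add b ((d1 _ _ _ _).fun_sub (d1 _ _ _ _))
        (DifferentiableAt.fun_sum fun m _ =>
          ((dΓ _ _ _).fun_mul (dΓ _ _ _)).fun_sub ((dΓ _ _ _).fun_mul (dΓ _ _ _))),
      pd_sub b (d1 _ _ _ _) (d1 _ _ _ _),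
      pd_sum b fun m => ((dΓ _ _ _).fun_mul (dΓ _ _ _)).fun_sub ((dΓ _ _ _).fun_mul (dΓ _ _ _))]
    have : ∀ m, pd b n (fun w => christoffel b g m i j w * christoffel b g q m k w
          - christoffel b g m i k w * christoffel b g q m j w) z
        = pd b n (christoffel b g m i j) z * christoffel b g q m k z
          + christoffel b g m i j z * pd b n (christoffel b g q m k) z
          - (pd b n (christoffel b g m i k) z * christoffel b g q m j z
          + christoffel b g m i k z * pd b n (christoffel b g q m j) z) := by
      intro m
      rw [pd_sub b ((dΓ _ _ _).fun_mul (dΓ _ _ _)) ((dΓ _ _ _).fun_mul (dΓ _ _ _)),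
        pd_mul b (dΓ _ _ _) (dΓ _ _ _), pd_mul b (dΓ _ _ _) (dΓ _ _ _)]
    simp only [this, A, D, DD, Matrix.sub_apply, Matrix.add_apply, Matrix.mul_apply,
      Matrix.of_apply]
    rw [add_sub_assoc, ← Finset.sum_add_distrib, ← Finset.sum_add_distrib,
      ← Finset.sum_sub_distrib]
    congr 1
    exact Finset.sum_congr rfl fun m _ => by ring
  have hB : ∀ n j k, B n j k =
      (DD n k j - DD n j k + (D n k * A j + A k * D n j) - (D n j * A k + A j * D n k)
        + (A n * W j k - W j k * A n)) q i := by
    intro n j k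
    simp only [B, hdW, hW]
    rw [Matrix.add_apply, Matrix.sub_apply (A n * _), Matrix.mul_apply, Matrix.mul_apply,
      ← Finset.sum_sub_distrib]
    rfl
  simp only [hB]
  rw [← Matrix.add_apply, ← Matrix.add_apply]
  refine congrFun (congrFun (?_ : _ = (0 : Matrix ι ι ℝ)) q) i
  rw [hDD n k j, hDD j n k, hDD k j n]
  simp only [W]
  noncomm_ring

/-- Schur's lemma in coordinates. -/
theorem IsMetricOn.schur (h : IsMetricOn g s) (b : Basis ι ℝ E) (hι : 3 ≤ Fintype.card ι)
    {μ : E → ℝ} (hμ : ContDiffOn ℝ ∞ μ s)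
    (hR : ∀ z ∈ s, ∀ i j k l, riem b g z i j k l = μ z * (1 / 2 * kn (g z) (g z) i j k l))
    {z : E} (hz : z ∈ s) (n : ι) : pd b n μ z = 0 := by
  have hW : ∀ w ∈ s, ∀ l i j k, curvOp b g w l i j k =
      μ w * ((if l = k then 1 else 0) * g w i j - (if l = j then 1 else 0) * g w i k) := by
    intro w hw l i j k
    rw [← h.raise_riem b hw, ← h.inv_mul hw l k, ← h.inv_mul hw l j, Finset.sum_mul,
      Finset.sum_mul, ← Finset.sum_sub_distrib, Finset.mul_sum]
    refine Finset.sum_congr rfl fun m _ => ?_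
    rw [hR w hw, half_kn_self]; ring
  have dμ := differentiableAt_of_contDiffOn h.isOpen hμ hz
  have hdW : ∀ n l i j k, pd b n (fun w => curvOp b g w l i j k) z =
      pd b n μ z * ((if l = k then 1 else 0) * g z i j - (if l = j then 1 else 0) * g z i k)
      + μ z * ((if l = k then 1 else 0) * pd b n (fun w => g w i j) z
        - (if l = j then 1 else 0) * pd b n (fun w => g w i k) z) := by
    intro n l i j k
    have dc : ∀ (c : ℝ) i j, DifferentiableAt ℝ (fun w => c * g w i j) z := fun c i j =>
      (differentiableAt_const c).fun_mul (h.differentiableAt hz i j)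
    rw [pd_congr b h.isOpen (fun w hw => hW w hw l i j k) hz,
      pd_mul b dμ ((dc _ _ _).fun_sub (dc _ _ _)), pd_sub b (dc _ _ _) (dc _ _ _),
      pd_mul b (differentiableAt_const _) (h.differentiableAt hz i j),
      pd_mul b (differentiableAt_const _) (h.differentiableAt hz i k), pd_const, pd_const]
    ring
  -- The raised index of the Bianchi identity is set equal to `k`. With `n`, `j`, `k` distinct, most
  -- Kronecker deltas vanish, and the derivatives of the metric cancel against Christoffel terms by
  -- metric compatibility.
  have key : ∀ j k, j ≠ n → k ≠ n → k ≠ j → ∀ i, pd b n μ z * g z i j = pd b j μ z * g z i n := by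
    intro j k hjn hkn hkj i
    have hb := h.second_bianchi b hz k i n j k
    have hsum : ∀ n j k' : ι, ∑ m, (christoffel b g k m n z * curvOp b g z m i j k'
        - curvOp b g z k m j k' * christoffel b g m i n z)
        = μ z * (christoffel b g k k' n z * g z i j - christoffel b g k j n z * g z i k'
          - ((if k = k' then 1 else 0) * ∑ m, g z j m * christoffel b g m i n z
            - (if k = j then 1 else 0) * ∑ m, g z k' m * christoffel b g m i n z)) := by
      intro n j k'
      have e1 : ∀ m, christoffel b g k m n z * curvOp b g z m i j k'
          - curvOp b g z k m j k' * christoffel b g m i n z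
          = μ z * g z i j * (christoffel b g k m n z * (if m = k' then 1 else 0))
            - μ z * g z i k' * (christoffel b g k m n z * (if m = j then 1 else 0))
            - (μ z * (if k = k' then 1 else 0) * (g z j m * christoffel b g m i n z)
              - μ z * (if k = j then 1 else 0) * (g z k' m * christoffel b g m i n z)) := by
        intro m
        rw [hW z hz, hW z hz, h.symm z hz m j, h.symm z hz m k']; ring
      simp only [e1, Finset.sum_sub_distrib, ← Finset.mul_sum, mul_ite, mul_one, mul_zero,
        Finset.sum_ite_eq', Finset.mem_univ, if_true]
      split_ifs <;> ring
    simp only [hsum, hdW, h.pd_metric b hz] at hb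
    simp only [if_true, hkn, hkj, if_false] at hb
    have c1 := h.christoffel_symm b hz
    rw [c1 k n k, c1 k j k, c1 k n j] at hb
    have c2 : ∑ l, g z i l * christoffel b g l n j z = ∑ l, g z i l * christoffel b g l j n z :=
      Finset.sum_congr rfl fun l _ => by rw [c1]
    rw [c2] at hb
    linarith
  -- Dimension at least three provides the distinct indices. Contracting `key` with `g^{ji}` then
  -- gives `∂ₙ μ · δ_{jj} = ∂ⱼ μ · δ_{jn} = 0`.
  obtain ⟨j, hj⟩ : ∃ j, j ≠ n :=
    Fintype.exists_ne_of_one_lt_card (by omega) n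
  obtain ⟨k, hk⟩ : ∃ k, k ∉ ({n, j} : Finset ι) := by
    by_contra! hcon
    have := Finset.card_le_card (fun x _ => hcon x : (Finset.univ : Finset ι) ⊆ {n, j})
    rw [Finset.card_univ] at this
    have := Finset.card_le_two (a := n) (b := j)
    omega
  simp only [Finset.mem_insert, Finset.mem_singleton, not_or] at hk
  have hkey := key j k hj hk.1 hk.2
  have h1 := h.inv_mul hz j j
  have h2 := h.inv_mul hz j n
  rw [if_pos rfl] at h1
  rw [if_neg hj] at h2
  calc pd b n μ z = ∑ i, (g z)⁻¹ j i * (pd b n μ z * g z i j) := by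
        conv_lhs => rw [← mul_one (pd b n μ z), ← h1, Finset.mul_sum]
        exact Finset.sum_congr rfl fun i _ => by ring
    _ = pd b j μ z * ∑ i, (g z)⁻¹ j i * g z i n := by
        rw [Finset.mul_sum]
        exact Finset.sum_congr rfl fun i _ => by rw [hkey]; ring
    _ = 0 := by rw [h2, mul_zero]

end Schur

/-! ### Warped products in coordinates -/

section WarpedCoordinates

open Sum

variable {ι E : Type*} [Fintype ι] [DecidableEq ι] [NormedAddCommGroup E] [NormedSpace ℝ E]
  {ι' E' : Type*} [Fintype ι'] [DecidableEq ι'] [NormedAddCommGroup E'] [NormedSpace ℝ E']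

/-- The components of the warped product metric in product coordinates. -/
def blockMetric (g : E → Matrix ι ι ℝ) (g' : E' → Matrix ι' ι' ℝ) (f : E → ℝ) (w : E × E') :
    Matrix (ι ⊕ ι') (ι ⊕ ι') ℝ :=
  Matrix.fromBlocks (g w.1) 0 0 (f w.1 • g' w.2)

/-- The gradient `f^a = g^{ab} f_b`. -/
def gradient (b : Basis ι ℝ E) (g : E → Matrix ι ι ℝ) (f : E → ℝ) (a : ι) (z : E) : ℝ :=
  ∑ c, (g z)⁻¹ a c * pd b c f z

section ProductBasis

variable {ι E : Type*} [NormedAddCommGroup E] [NormedSpace ℝ E]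
  {ι' E' : Type*} [NormedAddCommGroup E'] [NormedSpace ℝ E']
  (b : Basis ι ℝ E) (b' : Basis ι' ℝ E')

theorem fderiv_comp_fst {u : E → ℝ} {z : E × E'} (hu : DifferentiableAt ℝ u z.1) (v : E × E') :
    fderiv ℝ (fun w : E × E' => u w.1) z v = fderiv ℝ u z.1 v.1 := by
  have := (hu.hasFDerivAt.comp z (hasFDerivAt_fst (p := z) (𝕜 := ℝ))).fderiv
  change fderiv ℝ (u ∘ Prod.fst) z v = _
  rw [this]; rfl

theorem fderiv_comp_snd {u : E' → ℝ} {z : E × E'} (hu : DifferentiableAt ℝ u z.2) (v : E × E') :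
    fderiv ℝ (fun w : E × E' => u w.2) z v = fderiv ℝ u z.2 v.2 := by
  have := (hu.hasFDerivAt.comp z (hasFDerivAt_snd (p := z) (𝕜 := ℝ))).fderiv
  change fderiv ℝ (u ∘ Prod.snd) z v = _
  rw [this]; rfl

theorem pd_inl_comp_fst {u : E → ℝ} {z : E × E'} (hu : DifferentiableAt ℝ u z.1) (i : ι) :
    pd (b.prod b') (inl i) (fun w => u w.1) z = pd b i u z.1 := by
  simp [pd, fderiv_comp_fst hu]

theorem pd_inr_comp_fst {u : E → ℝ} {z : E × E'} (hu : DifferentiableAt ℝ u z.1) (i : ι') :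
    pd (b.prod b') (inr i) (fun w => u w.1) z = 0 := by
  simp [pd, fderiv_comp_fst hu]

theorem pd_inl_comp_snd {u : E' → ℝ} {z : E × E'} (hu : DifferentiableAt ℝ u z.2) (i : ι) :
    pd (b.prod b') (inl i) (fun w => u w.2) z = 0 := by
  simp [pd, fderiv_comp_snd hu]

theorem pd_inr_comp_snd {u : E' → ℝ} {z : E × E'} (hu : DifferentiableAt ℝ u z.2) (i : ι') :
    pd (b.prod b') (inr i) (fun w => u w.2) z = pd b' i u z.2 := by
  simp [pd, fderiv_comp_snd hu]

theorem pd_inl_mul {u : E → ℝ} {v : E' → ℝ} {z : E × E'} (hu : DifferentiableAt ℝ u z.1)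
    (hv : DifferentiableAt ℝ v z.2) (i : ι) :
    pd (b.prod b') (inl i) (fun w => u w.1 * v w.2) z = pd b i u z.1 * v z.2 := by
  have h1 : DifferentiableAt ℝ (fun w : E × E' => u w.1) z := hu.comp z differentiableAt_fst
  have h2 : DifferentiableAt ℝ (fun w : E × E' => v w.2) z := hv.comp z differentiableAt_snd
  rw [pd_mul _ h1 h2, pd_inl_comp_fst b b' hu, pd_inl_comp_snd b b' hv, mul_zero, add_zero]

theorem pd_inr_mul {u : E → ℝ} {v : E' → ℝ} {z : E × E'} (hu : DifferentiableAt ℝ u z.1)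
    (hv : DifferentiableAt ℝ v z.2) (i : ι') :
    pd (b.prod b') (inr i) (fun w => u w.1 * v w.2) z = u z.1 * pd b' i v z.2 := by
  have h1 : DifferentiableAt ℝ (fun w : E × E' => u w.1) z := hu.comp z differentiableAt_fst
  have h2 : DifferentiableAt ℝ (fun w : E × E' => v w.2) z := hv.comp z differentiableAt_snd
  rw [pd_mul _ h1 h2, pd_inr_comp_fst b b' hu, pd_inr_comp_snd b b' hv, zero_mul, zero_add]

end ProductBasis

/-- The data of a warped product in product coordinates ranging over `s ×ˢ t`. -/
structure IsWarpedOn (g : E → Matrix ι ι ℝ) (s : Set E) (g' : E' → Matrix ι' ι' ℝ) (t : Set E')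
    (f : E → ℝ) : Prop where
  base : IsMetricOn g s
  fiber : IsMetricOn g' t
  smooth : ContDiffOn ℝ ∞ f s
  ne_zero : ∀ z ∈ s, f z ≠ 0

namespace IsWarpedOn

variable {g : E → Matrix ι ι ℝ} {s : Set E} {g' : E' → Matrix ι' ι' ℝ} {t : Set E'} {f : E → ℝ}
  {z : E × E'}

theorem inv_blockMetric (H : IsWarpedOn g s g' t f) (hz : z ∈ s ×ˢ t) : (blockMetric g g' f z)⁻¹ =
    Matrix.fromBlocks (g z.1)⁻¹ 0 0 ((f z.1)⁻¹ • (g' z.2)⁻¹) := by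
  apply Matrix.inv_eq_right_inv
  rw [blockMetric, Matrix.fromBlocks_multiply]
  have h1 := Matrix.mul_nonsing_inv _ (H.base.isUnit z.1 hz.1)
  have h2 := Matrix.mul_nonsing_inv _ (H.fiber.isUnit z.2 hz.2)
  simp [h1, h2, H.ne_zero z.1 hz.1, smul_smul, ← Matrix.fromBlocks_one]


theorem differentiableAt_warping (H : IsWarpedOn g s g' t f) (hz : z ∈ s ×ˢ t) :
    DifferentiableAt ℝ f z.1 :=
  differentiableAt_of_contDiffOn H.base.isOpen H.smooth hz.1

theorem isMetricOn (H : IsWarpedOn g s g' t f) :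
    IsMetricOn (blockMetric g g' f) (s ×ˢ t) where
  isOpen := H.base.isOpen.prod H.fiber.isOpen
  smooth := by
    rintro (i | i) (j | j)
    · exact (H.base.smooth i j).comp contDiffOn_fst fun w hw => hw.1
    · exact contDiffOn_const
    · exact contDiffOn_const
    · exact (H.smooth.comp contDiffOn_fst fun w hw => hw.1).mul
        ((H.fiber.smooth i j).comp contDiffOn_snd fun w hw => hw.2)
  symm := by
    rintro z hz (i | i) (j | j)
    · exact H.base.symm z.1 hz.1 i j
    · rfl
    · rfl
    · exact congrArg (f z.1 * ·) (H.fiber.symm z.2 hz.2 i j)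
  isUnit := by
    intro z hz
    have h := (H.base.isUnit z.1 hz.1).ne_zero
    have h' := (H.fiber.isUnit z.2 hz.2).ne_zero
    have hf := H.ne_zero z.1 hz.1
    simp [blockMetric, Matrix.det_fromBlocks_zero₂₁, h, h', hf]

theorem differentiableAt_gradient (H : IsWarpedOn g s g' t f) (b : Basis ι ℝ E) (a : ι) {x : E}
    (hx : x ∈ s) : DifferentiableAt ℝ (gradient b g f a) x := by
  refine DifferentiableAt.fun_sum fun c _ => DifferentiableAt.fun_mul ?_ ?_
  · exact differentiableAt_of_contDiffOn H.base.isOpen (H.base.smooth_inv a c) hx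
  · exact differentiableAt_of_contDiffOn H.base.isOpen (contDiffOn_pd b H.base.isOpen H.smooth c) hx

theorem lower_gradient (H : IsWarpedOn g s g' t f) (b : Basis ι ℝ E) (a : ι) {x : E}
    (hx : x ∈ s) : ∑ c, g x a c * gradient b g f c x = pd b a f x :=
  H.base.lower_raise hx (fun c => pd b c f x) a

/-- Lowering the index of the covariant derivative of the gradient gives the Hessian. -/
theorem lower_gradient_deriv (H : IsWarpedOn g s g' t f) (b : Basis ι ℝ E) (a d : ι) {x : E}
    (hx : x ∈ s) :
    ∑ c, g x a c * (pd b d (gradient b g f c) x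
      + ∑ e, gradient b g f e x * christoffel b g c e d x) = hess b g f x a d := by
  -- The identity `g_{ac} f^c = f_a` is differentiated, and metric compatibility replaces the
  -- derivatives of `g` by Christoffel symbols.
  have h1 := pd_congr b H.base.isOpen (fun w hw => (H.lower_gradient b a hw).symm) hx d
  have hd : ∀ c, DifferentiableAt ℝ (gradient b g f c) x := fun c =>
    H.differentiableAt_gradient b c hx
  rw [pd_sum b fun c => (H.base.differentiableAt hx a c).fun_mul (hd c)] at h1
  simp only [pd_mul b (H.base.differentiableAt hx a _) (hd _), H.base.pd_metric b hx] at h1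
  rw [hess, Matrix.of_apply]
  change _ = pd b d (fun w => pd b a f w) x - _
  rw [h1]
  simp only [add_mul, mul_add, Finset.sum_add_distrib, ← H.lower_gradient b _ hx, Finset.mul_sum,
    Finset.sum_mul]
  have e1 : ∑ x_1, ∑ i, g x a i * christoffel b g i x_1 d x * gradient b g f x_1 x
      = ∑ x_1, ∑ i, g x a x_1 * (gradient b g f i x * christoffel b g x_1 i d x) := by
    rw [Finset.sum_comm]
    exact Finset.sum_congr rfl fun _ _ => Finset.sum_congr rfl fun _ _ => by ring
  have e2 : ∑ x_1, ∑ i, g x x_1 i * christoffel b g i a d x * gradient b g f x_1 x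
      = ∑ x_1, ∑ i, christoffel b g x_1 a d x * (g x x_1 i * gradient b g f i x) := by
    rw [Finset.sum_comm]
    refine Finset.sum_congr rfl fun i _ => Finset.sum_congr rfl fun j _ => ?_
    rw [H.base.symm x hx]; ring
  rw [e1, e2]; ring

/-! ### Christoffel symbols of a warped product, block by block -/

section Christoffel

variable {a c d : ι} {α β γ : ι'}

theorem pd_inl_base (H : IsWarpedOn g s g' t f) (b : Basis ι ℝ E) (b' : Basis ι' ℝ E')
    (hz : z ∈ s ×ˢ t) :
    pd (b.prod b') (inl a) (fun w => blockMetric g g' f w (inl c) (inl d)) z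
      = pd b a (fun w => g w c d) z.1 :=
  pd_inl_comp_fst b b' (H.base.differentiableAt hz.1 c d) a

theorem pd_inr_base (H : IsWarpedOn g s g' t f) (b : Basis ι ℝ E) (b' : Basis ι' ℝ E')
    (hz : z ∈ s ×ˢ t) :
    pd (b.prod b') (inr α) (fun w => blockMetric g g' f w (inl c) (inl d)) z = 0 :=
  pd_inr_comp_fst b b' (H.base.differentiableAt hz.1 c d) α

theorem pd_mixed {ι ι' E E' : Type*} [NormedAddCommGroup E] [NormedSpace ℝ E]
    [NormedAddCommGroup E'] [NormedSpace ℝ E'] {g : E → Matrix ι ι ℝ} {g' : E' → Matrix ι' ι' ℝ}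
    {f : E → ℝ} {z : E × E'} {c : ι} {β : ι'} (b : Basis ι ℝ E) (b' : Basis ι' ℝ E') (i : ι ⊕ ι') :
    pd (b.prod b') i (fun w => blockMetric g g' f w (inl c) (inr β)) z = 0 :=
  pd_const _ _ _ _

theorem pd_mixed' {ι ι' E E' : Type*} [NormedAddCommGroup E] [NormedSpace ℝ E]
    [NormedAddCommGroup E'] [NormedSpace ℝ E'] {g : E → Matrix ι ι ℝ} {g' : E' → Matrix ι' ι' ℝ}
    {f : E → ℝ} {z : E × E'} {c : ι} {β : ι'} (b : Basis ι ℝ E) (b' : Basis ι' ℝ E') (i : ι ⊕ ι') :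
    pd (b.prod b') i (fun w => blockMetric g g' f w (inr β) (inl c)) z = 0 :=
  pd_const _ _ _ _

theorem pd_inl_fiber (H : IsWarpedOn g s g' t f) (b : Basis ι ℝ E) (b' : Basis ι' ℝ E')
    (hz : z ∈ s ×ˢ t) :
    pd (b.prod b') (inl a) (fun w => blockMetric g g' f w (inr β) (inr γ)) z
      = pd b a f z.1 * g' z.2 β γ :=
  pd_inl_mul b b' (H.differentiableAt_warping hz) (H.fiber.differentiableAt hz.2 β γ) a

theorem pd_inr_fiber (H : IsWarpedOn g s g' t f) (b : Basis ι ℝ E) (b' : Basis ι' ℝ E')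
    (hz : z ∈ s ×ˢ t) :
    pd (b.prod b') (inr α) (fun w => blockMetric g g' f w (inr β) (inr γ)) z
      = f z.1 * pd b' α (fun w => g' w β γ) z.2 :=
  pd_inr_mul b b' (H.differentiableAt_warping hz) (H.fiber.differentiableAt hz.2 β γ) α

theorem christoffel_base (H : IsWarpedOn g s g' t f) (b : Basis ι ℝ E) (b' : Basis ι' ℝ E')
    (hz : z ∈ s ×ˢ t) (a c d : ι) :
    christoffel (b.prod b') (blockMetric g g' f) (inl a) (inl c) (inl d) z
      = christoffel b g a c d z.1 := by
  simp [christoffel, H.inv_blockMetric hz, H.pd_inl_base b b' hz]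

theorem christoffel_base_mixed (H : IsWarpedOn g s g' t f) (b : Basis ι ℝ E) (b' : Basis ι' ℝ E')
    (hz : z ∈ s ×ˢ t) (a c : ι) (β : ι') :
    christoffel (b.prod b') (blockMetric g g' f) (inl a) (inl c) (inr β) z = 0 := by
  simp [christoffel, H.inv_blockMetric hz, H.pd_inr_base b b' hz, pd_mixed]

theorem christoffel_base_mixed' (H : IsWarpedOn g s g' t f) (b : Basis ι ℝ E) (b' : Basis ι' ℝ E')
    (hz : z ∈ s ×ˢ t) (a c : ι) (β : ι') :
    christoffel (b.prod b') (blockMetric g g' f) (inl a) (inr β) (inl c) z = 0 := by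
  rw [H.isMetricOn.christoffel_symm _ hz, H.christoffel_base_mixed b b' hz]

theorem christoffel_base_fiber (H : IsWarpedOn g s g' t f) (b : Basis ι ℝ E) (b' : Basis ι' ℝ E')
    (hz : z ∈ s ×ˢ t) (a : ι) (β γ : ι') :
    christoffel (b.prod b') (blockMetric g g' f) (inl a) (inr β) (inr γ) z
      = (-(1 / 2) * gradient b g f a z.1) * g' z.2 β γ := by
  simp only [christoffel, H.inv_blockMetric hz, H.pd_inl_fiber b b' hz, pd_mixed,
    Fintype.sum_sum_type, Matrix.fromBlocks_apply₁₁, Matrix.fromBlocks_apply₁₂, gradient,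
    Matrix.zero_apply, zero_mul, Finset.sum_const_zero, add_zero, Finset.mul_sum, Finset.sum_mul]
  exact Finset.sum_congr rfl fun _ _ => by ring

theorem christoffel_fiber_base (H : IsWarpedOn g s g' t f) (b : Basis ι ℝ E) (b' : Basis ι' ℝ E')
    (hz : z ∈ s ×ˢ t) (α : ι') (c d : ι) :
    christoffel (b.prod b') (blockMetric g g' f) (inr α) (inl c) (inl d) z = 0 := by
  simp [christoffel, H.inv_blockMetric hz, H.pd_inr_base b b' hz, pd_mixed']

theorem christoffel_fiber_mixed (H : IsWarpedOn g s g' t f) (b : Basis ι ℝ E)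
    (b' : Basis ι' ℝ E') (hz : z ∈ s ×ˢ t) (α : ι') (c : ι) (β : ι') :
    christoffel (b.prod b') (blockMetric g g' f) (inr α) (inl c) (inr β) z
      = (1 / 2 * pd b c f z.1 * (f z.1)⁻¹) * (if α = β then 1 else 0) := by
  simp only [christoffel, H.inv_blockMetric hz, H.pd_inl_fiber b b' hz, pd_mixed, pd_mixed',
    Fintype.sum_sum_type, Matrix.fromBlocks_apply₂₁, Matrix.fromBlocks_apply₂₂,
    Matrix.zero_apply, zero_mul, Finset.sum_const_zero, zero_add, add_zero, sub_zero,
    Matrix.smul_apply, smul_eq_mul]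
  rw [← H.fiber.inv_mul hz.2 α β, Finset.mul_sum, Finset.mul_sum]
  exact Finset.sum_congr rfl fun _ _ => by ring

theorem christoffel_fiber_mixed' (H : IsWarpedOn g s g' t f) (b : Basis ι ℝ E)
    (b' : Basis ι' ℝ E') (hz : z ∈ s ×ˢ t) (α : ι') (c : ι) (β : ι') :
    christoffel (b.prod b') (blockMetric g g' f) (inr α) (inr β) (inl c) z
      = (1 / 2 * pd b c f z.1 * (f z.1)⁻¹) * (if α = β then 1 else 0) := by
  rw [H.isMetricOn.christoffel_symm _ hz, H.christoffel_fiber_mixed b b' hz]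

theorem christoffel_fiber (H : IsWarpedOn g s g' t f) (b : Basis ι ℝ E) (b' : Basis ι' ℝ E')
    (hz : z ∈ s ×ˢ t) (α β γ : ι') :
    christoffel (b.prod b') (blockMetric g g' f) (inr α) (inr β) (inr γ) z
      = christoffel b' g' α β γ z.2 := by
  have hf := H.ne_zero z.1 hz.1
  simp only [christoffel, H.inv_blockMetric hz, H.pd_inr_fiber b b' hz, pd_mixed,
    Fintype.sum_sum_type, Matrix.fromBlocks_apply₂₁, Matrix.fromBlocks_apply₂₂,
    Matrix.zero_apply, zero_mul, Finset.sum_const_zero, zero_add,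
    Matrix.smul_apply, smul_eq_mul]
  congr 1
  exact Finset.sum_congr rfl fun _ _ => by field_simp

end Christoffel

/-! ### Curvature and Ricci tensors of a warped product -/

section Curvature

/-- The base slices are totally geodesic: the symbols with upper fiber index and two lower base
indices vanish, so the fiber contributes nothing. -/
theorem curvOp_base (H : IsWarpedOn g s g' t f) (b : Basis ι ℝ E) (b' : Basis ι' ℝ E')
    (hz : z ∈ s ×ˢ t) (l a c d : ι) :
    curvOp (b.prod b') (blockMetric g g' f) z (inl l) (inl a) (inl c) (inl d)
      = curvOp b g z.1 l a c d := by
  have hG : ∀ a c d e, pd (b.prod b') (inl e)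
      (christoffel (b.prod b') (blockMetric g g' f) (inl a) (inl c) (inl d)) z
      = pd b e (christoffel b g a c d) z.1 := fun a c d e => by
    rw [pd_congr _ H.isMetricOn.isOpen (fun w hw => H.christoffel_base b b' hw a c d) hz,
      pd_inl_comp_fst b b' (H.base.differentiableAt_christoffel b a c d hz.1)]
  simp [curvOp, hG, H.christoffel_base b b' hz, H.christoffel_fiber_base b b' hz]

theorem curvOp_base_fiber_fiber_base (H : IsWarpedOn g s g' t f) (b : Basis ι ℝ E)
    (b' : Basis ι' ℝ E') (hz : z ∈ s ×ˢ t) (l d : ι) (β γ : ι') :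
    curvOp (b.prod b') (blockMetric g g' f) z (inl l) (inr β) (inr γ) (inl d)
      = -(1 / 2) * g' z.2 β γ * (pd b d (gradient b g f l) z.1
          + ∑ e, gradient b g f e z.1 * christoffel b g l e d z.1
          - 1 / 2 * pd b d f z.1 * (f z.1)⁻¹ * gradient b g f l z.1) := by
  have hG : pd (b.prod b') (inl d)
      (christoffel (b.prod b') (blockMetric g g' f) (inl l) (inr β) (inr γ)) z
      = (-(1 / 2) * pd b d (gradient b g f l) z.1) * g' z.2 β γ := by
    have hd := H.differentiableAt_gradient b l hz.1
    rw [pd_congr _ H.isMetricOn.isOpen (fun w hw => H.christoffel_base_fiber b b' hw l β γ) hz,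
      pd_inl_mul b b' ((differentiableAt_const _).fun_mul hd) (H.fiber.differentiableAt hz.2 β γ),
      pd_mul b (differentiableAt_const _) hd, pd_const]
    ring
  have hG' : pd (b.prod b') (inr γ)
      (christoffel (b.prod b') (blockMetric g g' f) (inl l) (inr β) (inl d)) z = 0 := by
    rw [pd_congr _ H.isMetricOn.isOpen (fun w hw => H.christoffel_base_mixed' b b' hw l d β) hz,
      pd_const]
  simp only [curvOp, hG, hG', Fintype.sum_sum_type, H.christoffel_base b b' hz,
    H.christoffel_base_mixed' b b' hz, H.christoffel_base_fiber b b' hz,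
    H.christoffel_fiber_mixed' b b' hz, zero_mul, mul_zero, sub_zero, zero_sub]
  simp only [mul_ite, ite_mul, mul_one, mul_zero, zero_mul, Finset.sum_neg_distrib,
    Finset.sum_ite_eq', Finset.mem_univ, if_true]
  have : ∑ x, -(1 / 2) * gradient b g f x z.1 * g' z.2 β γ * christoffel b g l x d z.1
      = -(1 / 2) * g' z.2 β γ * ∑ e, gradient b g f e z.1 * christoffel b g l e d z.1 := by
    rw [Finset.mul_sum]
    exact Finset.sum_congr rfl fun _ _ => by ring
  rw [this]; ring

/-- The fiber index enters only through a Kronecker delta. Contracting it yields the summand `m T`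
of the base block of the Ricci tensor. -/
theorem curvOp_fiber_base_base_fiber (H : IsWarpedOn g s g' t f) (b : Basis ι ℝ E)
    (b' : Basis ι' ℝ E') (hz : z ∈ s ×ˢ t) (l δ : ι') (a c : ι) :
    curvOp (b.prod b') (blockMetric g g' f) z (inr l) (inl a) (inl c) (inr δ)
      = tensorT b g f z.1 a c * (if l = δ then 1 else 0) := by
  have hf := H.ne_zero z.1 hz.1
  have hG : pd (b.prod b') (inl c)
      (christoffel (b.prod b') (blockMetric g g' f) (inr l) (inl a) (inr δ)) z
      = (1 / 2 * (pd b c (pd b a f) z.1 * (f z.1)⁻¹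
        - pd b a f z.1 * (pd b c f z.1 / f z.1 ^ 2))) * (if l = δ then 1 else 0) := by
    have d1 := H.differentiableAt_warping hz
    have d2 := differentiableAt_of_contDiffOn H.base.isOpen
      (contDiffOn_pd b H.base.isOpen H.smooth a) hz.1
    have d3 : DifferentiableAt ℝ (fun w => (f w)⁻¹) z.1 := d1.fun_inv hf
    have hinv : pd b c (fun w => (f w)⁻¹) z.1 = -(pd b c f z.1 / f z.1 ^ 2) := by
      have := ((hasDerivAt_inv hf).comp_hasFDerivAt z.1 d1.hasFDerivAt).fderiv
      change fderiv ℝ ((fun x => x⁻¹) ∘ f) z.1 (b c) = _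
      rw [this]
      simp [pd, div_eq_mul_inv, mul_comm]
    have d4 := (differentiableAt_const (1 / 2 : ℝ)).fun_mul d2
    rw [pd_congr _ H.isMetricOn.isOpen (fun w hw => H.christoffel_fiber_mixed b b' hw l a δ) hz,
      pd_inl_mul b b' (v := fun _ => if l = δ then 1 else 0) (d4.fun_mul d3)
        (differentiableAt_const _),
      pd_mul b d4 d3, pd_mul b (differentiableAt_const _) d2, pd_const, hinv]
    ring
  have hG' : pd (b.prod b') (inr δ)
      (christoffel (b.prod b') (blockMetric g g' f) (inr l) (inl a) (inl c)) z = 0 := by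
    rw [pd_congr _ H.isMetricOn.isOpen (fun w hw => H.christoffel_fiber_base b b' hw l a c) hz,
      pd_const]
  simp only [curvOp, hG, hG', Fintype.sum_sum_type, H.christoffel_base b b' hz,
    H.christoffel_base_mixed b b' hz, H.christoffel_fiber_base b b' hz,
    H.christoffel_fiber_mixed b b' hz, H.christoffel_fiber_mixed' b b' hz, zero_mul, mul_zero,
    sub_zero, zero_sub]
  simp only [tensorT, hess, Matrix.of_apply]
  have e1 : ∑ x, christoffel b g x a c z.1 *
        (1 / 2 * pd b x f z.1 * (f z.1)⁻¹ * if l = δ then 1 else 0)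
      = 1 / 2 * (f z.1)⁻¹ * (if l = δ then 1 else 0)
        * ∑ d, christoffel b g d a c z.1 * pd b d f z.1 := by
    rw [Finset.mul_sum]
    exact Finset.sum_congr rfl fun _ _ => by ring
  rw [e1]
  simp only [mul_ite, ite_mul, mul_one, mul_zero, zero_mul, Finset.sum_neg_distrib,
    Finset.sum_ite_eq, Finset.mem_univ, if_true]
  split_ifs with h
  · field_simp; ring
  · simp

/-- This is the Gauss equation. The fibers are umbilical with second fundamental form `-½ f^a
g̃_{βγ}`. The sums over base indices contribute its square, which is where `P`, a quarter of
`|∇f|²/f²`, comes from. -/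
theorem curvOp_fiber (H : IsWarpedOn g s g' t f) (b : Basis ι ℝ E) (b' : Basis ι' ℝ E')
    (hz : z ∈ s ×ˢ t) (l α β γ : ι') :
    curvOp (b.prod b') (blockMetric g g' f) z (inr l) (inr α) (inr β) (inr γ)
      = curvOp b' g' z.2 l α β γ - f z.1 * scalarP b g f z.1 *
          (g' z.2 α β * (if l = γ then 1 else 0) - g' z.2 α γ * (if l = β then 1 else 0)) := by
  have hf := H.ne_zero z.1 hz.1
  have hG : ∀ α β γ δ, pd (b.prod b') (inr δ)
      (christoffel (b.prod b') (blockMetric g g' f) (inr α) (inr β) (inr γ)) z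
      = pd b' δ (christoffel b' g' α β γ) z.2 := fun α β γ δ => by
    rw [pd_congr _ H.isMetricOn.isOpen (fun w hw => H.christoffel_fiber b b' hw α β γ) hz,
      pd_inr_comp_snd b b' (H.fiber.differentiableAt_christoffel b' α β γ hz.2)]
  have hP : f z.1 * scalarP b g f z.1
      = 1 / 4 * (f z.1)⁻¹ * ∑ c, gradient b g f c z.1 * pd b c f z.1 := by
    have : ∀ a, ∑ c, (g z.1)⁻¹ a c * (pd b a f z.1 * pd b c f z.1)
        = gradient b g f a z.1 * pd b a f z.1 := by
      intro a
      rw [gradient, Finset.sum_mul]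
      exact Finset.sum_congr rfl fun _ _ => by ring
    simp only [scalarP, this]
    field_simp
  have e1 : ∀ β' γ', ∑ c, (-(1 / 2) * gradient b g f c z.1 * g' z.2 α β' *
        (1 / 2 * pd b c f z.1 * (f z.1)⁻¹ * if l = γ' then 1 else 0))
      = - (f z.1 * scalarP b g f z.1 * (g' z.2 α β' * (if l = γ' then 1 else 0))) := by
    intro β' γ'
    rw [hP, Finset.mul_sum, Finset.sum_mul, ← Finset.sum_neg_distrib]
    exact Finset.sum_congr rfl fun _ _ => by ring
  simp only [curvOp, hG, Fintype.sum_sum_type, H.christoffel_base_fiber b b' hz,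
    H.christoffel_fiber_mixed b b' hz, H.christoffel_fiber b b' hz, Finset.sum_sub_distrib, e1]
  ring

theorem pd_christoffel_eq_zero (H : IsWarpedOn g s g' t f) (b : Basis ι ℝ E)
    (b' : Basis ι' ℝ E') (hz : z ∈ s ×ˢ t) {i j k : ι ⊕ ι'}
    (h : ∀ w ∈ s ×ˢ t, christoffel (b.prod b') (blockMetric g g' f) i j k w = 0) (n : ι ⊕ ι') :
    pd (b.prod b') n (christoffel (b.prod b') (blockMetric g g' f) i j k) z = 0 := by
  rw [pd_congr _ H.isMetricOn.isOpen h hz, pd_const]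

theorem pd_christoffel_fiber_mixed (H : IsWarpedOn g s g' t f) (b : Basis ι ℝ E)
    (b' : Basis ι' ℝ E') (hz : z ∈ s ×ˢ t) (l β γ : ι') (a : ι) :
    pd (b.prod b') (inr γ)
      (christoffel (b.prod b') (blockMetric g g' f) (inr l) (inl a) (inr β)) z = 0 := by
  have d3 : DifferentiableAt ℝ (fun w => (f w)⁻¹) z.1 :=
    (H.differentiableAt_warping hz).fun_inv (H.ne_zero z.1 hz.1)
  have d2 := differentiableAt_of_contDiffOn H.base.isOpen
    (contDiffOn_pd b H.base.isOpen H.smooth a) hz.1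
  rw [pd_congr _ H.isMetricOn.isOpen (fun w hw => H.christoffel_fiber_mixed b b' hw l a β) hz,
    pd_inr_mul b b' (v := fun _ => if l = β then 1 else 0)
      (((differentiableAt_const (1 / 2 : ℝ)).fun_mul d2).fun_mul d3)
      (differentiableAt_const _), pd_const, mul_zero]

theorem pd_christoffel_fiber_mixed' (H : IsWarpedOn g s g' t f) (b : Basis ι ℝ E)
    (b' : Basis ι' ℝ E') (hz : z ∈ s ×ˢ t) (l β γ : ι') (a : ι) :
    pd (b.prod b') (inr γ)
      (christoffel (b.prod b') (blockMetric g g' f) (inr l) (inr β) (inl a)) z = 0 := by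
  rw [pd_congr _ H.isMetricOn.isOpen
    (fun w hw => H.isMetricOn.christoffel_symm _ hw _ _ _) hz]
  exact H.pd_christoffel_fiber_mixed b b' hz l β γ a

/-- The derivative terms vanish because each symbol involved depends on the wrong factor only or is
zero. The two surviving products are `f_a/(2f)` times a contracted fiber symbol, and they cancel by
symmetry of `Γ`. -/
theorem ricci_mixed (H : IsWarpedOn g s g' t f) (b : Basis ι ℝ E) (b' : Basis ι' ℝ E')
    (hz : z ∈ s ×ˢ t) (a : ι) (β : ι') :
    ricci (b.prod b') (blockMetric g g' f) z (inl a) (inr β) = 0 := by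
  rw [H.isMetricOn.ricci_eq _ hz, Fintype.sum_sum_type]
  have h1 : ∀ c d, pd (b.prod b') (inr β)
      (christoffel (b.prod b') (blockMetric g g' f) (inl c) (inl a) (inl d)) z = 0 := by
    intro c d
    rw [pd_congr _ H.isMetricOn.isOpen (fun w hw => H.christoffel_base b b' hw c a d) hz,
      pd_inr_comp_fst b b' (H.base.differentiableAt_christoffel b c a d hz.1)]
  have h2 : ∀ c d, pd (b.prod b') d
      (christoffel (b.prod b') (blockMetric g g' f) (inl c) (inl a) (inr β)) z = 0 := fun c d =>
    H.pd_christoffel_eq_zero b b' hz (fun w hw => H.christoffel_base_mixed b b' hw c a β) d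
  simp only [curvOp, h1, h2, H.pd_christoffel_fiber_mixed b b' hz, Fintype.sum_sum_type,
    H.christoffel_base_mixed b b' hz, H.christoffel_base_mixed' b b' hz,
    H.christoffel_fiber_base b b' hz, H.christoffel_fiber_mixed b b' hz,
    H.christoffel_fiber b b' hz]
  simp [H.fiber.christoffel_symm b' hz.2 _ β]

/-- Symmetry of the Ricci tensor is not otherwise needed, so the transposed block is computed
directly. -/
theorem ricci_mixed' (H : IsWarpedOn g s g' t f) (b : Basis ι ℝ E) (b' : Basis ι' ℝ E')
    (hz : z ∈ s ×ˢ t) (a : ι) (β : ι') :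
    ricci (b.prod b') (blockMetric g g' f) z (inr β) (inl a) = 0 := by
  rw [H.isMetricOn.ricci_eq _ hz, Fintype.sum_sum_type]
  have h1 : ∀ c d e, pd (b.prod b') e
      (christoffel (b.prod b') (blockMetric g g' f) (inl c) (inr β) (inl d)) z = 0 := fun c d e =>
    H.pd_christoffel_eq_zero b b' hz (fun w hw => H.christoffel_base_mixed' b b' hw c d β) e
  have h2 : ∀ γ δ, pd (b.prod b') (inl a)
      (christoffel (b.prod b') (blockMetric g g' f) (inr γ) (inr β) (inr δ)) z = 0 := by
    intro γ δ
    rw [pd_congr _ H.isMetricOn.isOpen (fun w hw => H.christoffel_fiber b b' hw γ β δ) hz,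
      pd_inl_comp_snd b b' (H.fiber.differentiableAt_christoffel b' γ β δ hz.2)]
  simp only [curvOp, h1, h2, H.pd_christoffel_fiber_mixed' b b' hz, Fintype.sum_sum_type,
    H.christoffel_base_mixed' b b' hz, H.christoffel_fiber_base b b' hz,
    H.christoffel_fiber_mixed' b b' hz, H.christoffel_fiber b b' hz]
  simp [mul_comm]

theorem curvOp_base_fiber_fiber_base' (H : IsWarpedOn g s g' t f) (b : Basis ι ℝ E)
    (b' : Basis ι' ℝ E') (hz : z ∈ s ×ˢ t) (l d : ι) (β γ : ι') :
    curvOp (b.prod b') (blockMetric g g' f) z (inl l) (inr β) (inr γ) (inl d)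
      = f z.1 * g' z.2 β γ * ∑ a, (g z.1)⁻¹ l a * tensorT b g f z.1 a d := by
  have hf := H.ne_zero z.1 hz.1
  rw [H.curvOp_base_fiber_fiber_base b b' hz]
  set Y : ι → ℝ := fun l => pd b d (gradient b g f l) z.1
          + ∑ e, gradient b g f e z.1 * christoffel b g l e d z.1
          - 1 / 2 * pd b d f z.1 * (f z.1)⁻¹ * gradient b g f l z.1 with hY
  -- The vector `Y` is recognized as a multiple of `T` after lowering its index, where the
  -- derivative of the gradient becomes the Hessian. Raising the index again gives the claim.
  have hlow : ∀ a, ∑ c, g z.1 a c * Y c = -(2 * f z.1) * tensorT b g f z.1 a d := by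
    intro a
    simp only [hY, mul_sub, Finset.sum_sub_distrib, H.lower_gradient_deriv b a d hz.1]
    have : ∑ c, g z.1 a c * (1 / 2 * pd b d f z.1 * (f z.1)⁻¹ * gradient b g f c z.1)
        = 1 / 2 * pd b d f z.1 * (f z.1)⁻¹ * pd b a f z.1 := by
      rw [← H.lower_gradient b a hz.1, Finset.mul_sum]
      exact Finset.sum_congr rfl fun _ _ => by ring
    rw [this]
    simp only [tensorT, Matrix.of_apply]
    field_simp
  change -(1 / 2) * g' z.2 β γ * Y l = _
  rw [← H.base.raise_lower hz.1 Y l]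
  simp only [hlow, Finset.mul_sum]
  exact Finset.sum_congr rfl fun _ _ => by ring

theorem ricci_base (H : IsWarpedOn g s g' t f) (b : Basis ι ℝ E) (b' : Basis ι' ℝ E')
    (hz : z ∈ s ×ˢ t) (a c : ι) :
    ricci (b.prod b') (blockMetric g g' f) z (inl a) (inl c)
      = ricci b g z.1 a c + Fintype.card ι' * tensorT b g f z.1 a c := by
  rw [H.isMetricOn.ricci_eq _ hz, Fintype.sum_sum_type, H.base.ricci_eq b hz.1]
  simp [H.curvOp_base b b' hz, H.curvOp_fiber_base_base_fiber b b' hz]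

/-- The base indices contribute `f tr(T) g̃` to the contraction. The Gauss term contributes `-f P (m
- 1) g̃`, with `m - 1` coming from the trace `m` of one delta minus the other delta. -/
theorem ricci_fiber (H : IsWarpedOn g s g' t f) (b : Basis ι ℝ E) (b' : Basis ι' ℝ E')
    (hz : z ∈ s ×ˢ t) (β γ : ι') :
    ricci (b.prod b') (blockMetric g g' f) z (inr β) (inr γ)
      = ricci b' g' z.2 β γ + f z.1 * (tr (g z.1) (tensorT b g f z.1)
          - ((Fintype.card ι' : ℝ) - 1) * scalarP b g f z.1) * g' z.2 β γ := by
  rw [H.isMetricOn.ricci_eq _ hz, Fintype.sum_sum_type, H.fiber.ricci_eq b' hz.2]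
  have h1 : tr (g z.1) (tensorT b g f z.1)
      = ∑ l, ∑ a, (g z.1)⁻¹ l a * tensorT b g f z.1 a l := by
    rw [tr, Finset.sum_comm]
    exact Finset.sum_congr rfl fun l _ => Finset.sum_congr rfl fun a _ => by
      rw [H.base.inv_symm hz.1]
  simp only [H.curvOp_base_fiber_fiber_base' b b' hz, H.curvOp_fiber b b' hz, ← Finset.mul_sum,
    Finset.sum_sub_distrib, ← h1]
  simp
  ring

theorem riem_base (H : IsWarpedOn g s g' t f) (b : Basis ι ℝ E) (b' : Basis ι' ℝ E')
    (hz : z ∈ s ×ˢ t) (h a c d : ι) :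
    riem (b.prod b') (blockMetric g g' f) z (inl h) (inl a) (inl c) (inl d)
      = riem b g z.1 h a c d := by
  simp [riem_eq_sum_curvOp, H.curvOp_base b b' hz, blockMetric]

theorem riem_base_fiber_fiber_base (H : IsWarpedOn g s g' t f) (b : Basis ι ℝ E)
    (b' : Basis ι' ℝ E') (hz : z ∈ s ×ˢ t) (a d : ι) (β γ : ι') :
    riem (b.prod b') (blockMetric g g' f) z (inl a) (inr β) (inr γ) (inl d)
      = f z.1 * tensorT b g f z.1 a d * g' z.2 β γ := by
  rw [← H.base.lower_raise hz.1 (fun a => tensorT b g f z.1 a d) a]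
  simp only [riem_eq_sum_curvOp, Fintype.sum_sum_type, H.curvOp_base_fiber_fiber_base' b b' hz,
    blockMetric, Matrix.fromBlocks_apply₁₁, Matrix.fromBlocks_apply₁₂, Matrix.zero_apply, zero_mul,
    Finset.sum_const_zero, add_zero]
  rw [mul_right_comm, Finset.mul_sum]
  exact Finset.sum_congr rfl fun _ _ => by ring

theorem riem_fiber (H : IsWarpedOn g s g' t f) (b : Basis ι ℝ E) (b' : Basis ι' ℝ E')
    (hz : z ∈ s ×ˢ t) (α β γ δ : ι') :
    riem (b.prod b') (blockMetric g g' f) z (inr α) (inr β) (inr γ) (inr δ)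
      = f z.1 * riem b' g' z.2 α β γ δ
        - f z.1 ^ 2 * scalarP b g f z.1 * (1 / 2 * kn (g' z.2) (g' z.2) α β γ δ) := by
  have h1 : ∀ β γ δ, ∑ l, g' z.2 α l * (g' z.2 β γ * if l = δ then 1 else 0)
      = g' z.2 α δ * g' z.2 β γ := by
    intro β γ δ; simp
  simp only [riem_eq_sum_curvOp, Fintype.sum_sum_type, H.curvOp_fiber b b' hz,
    blockMetric, Matrix.fromBlocks_apply₂₁, Matrix.fromBlocks_apply₂₂, Matrix.zero_apply, zero_mul,
    Finset.sum_const_zero, zero_add, Matrix.smul_apply, smul_eq_mul, half_kn_self]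
  rw [← h1 β γ δ, ← h1 β δ γ, ← Finset.sum_sub_distrib, Finset.mul_sum, Finset.mul_sum,
    ← Finset.sum_sub_distrib]
  exact Finset.sum_congr rfl fun _ _ => by ring

end Curvature

end IsWarpedOn
end WarpedCoordinates

/-! ### Locality of the curvature -/

section Congruence

variable {ι E : Type*} [Fintype ι] [DecidableEq ι] [NormedAddCommGroup E] [NormedSpace ℝ E]
  {g g' : E → Matrix ι ι ℝ} {z : E}

theorem christoffel_congr (b : Basis ι ℝ E) (h : g =ᶠ[nhds z] g') (l i j : ι) :
    christoffel b g l i j z = christoffel b g' l i j z := by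
  have hp : ∀ k i j, pd b k (fun w => g w i j) z = pd b k (fun w => g' w i j) z := fun k i j =>
    pd_congr_of_eventuallyEq b (h.mono fun w hw => by simp only [hw]) k
  simp only [christoffel, hp, h.eq_of_nhds]

/-- The components of the warped metric in a product chart are known to agree with `blockMetric`
only over the chart image. Agreement near the point suffices, since curvature depends on the metric
through its derivatives there. -/
theorem riem_congr (b : Basis ι ℝ E) (h : g =ᶠ[nhds z] g') : riem b g z = riem b g' z := by
  have hc : ∀ l i j, christoffel b g l i j =ᶠ[nhds z] christoffel b g' l i j := fun l i j =>
    h.eventually_nhds.mono fun w hw => christoffel_congr b hw l i j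
  ext i j k l
  simp only [riem, h.eq_of_nhds, pd_congr_of_eventuallyEq b (hc _ _ _), (hc _ _ _).eq_of_nhds]

theorem ricci_congr (b : Basis ι ℝ E) (h : g =ᶠ[nhds z] g') : ricci b g z = ricci b g' z := by
  simp only [ricci, riem_congr b h, h.eq_of_nhds]

end Congruence

/-! ### Metrics in the charts of a manifold -/

section Charts

theorem isOpen_extend_target {E M : Type*} [NormedAddCommGroup E] [NormedSpace ℝ E]
    [TopologicalSpace M] (e : OpenPartialHomeomorph M E) :
    IsOpen (e.extend 𝓘(ℝ, E)).target := by
  simpa [mfld_simps] using e.open_target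

variable {ι E M : Type*} [Fintype ι] [DecidableEq ι] [NormedAddCommGroup E] [NormedSpace ℝ E]
  [TopologicalSpace M] [ChartedSpace E M] [IsManifold 𝓘(ℝ, E) ∞ M]
  {e : OpenPartialHomeomorph M E}

theorem mdifferentiableAt_extend_symm (he : e ∈ atlas E M) {z : E}
    (hz : z ∈ (e.extend 𝓘(ℝ, E)).target) :
    MDifferentiableAt 𝓘(ℝ, E) 𝓘(ℝ, E) (e.extend 𝓘(ℝ, E)).symm z := by
  have h := contMDiffOn_extend_symm (I := 𝓘(ℝ, E)) (n := ∞)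
    (IsManifold.subset_maximalAtlas (I := 𝓘(ℝ, E)) (n := ∞) he)
  have h' : ContMDiffOn 𝓘(ℝ, E) 𝓘(ℝ, E) ∞ (e.extend 𝓘(ℝ, E)).symm
      (e.extend 𝓘(ℝ, E)).target := by
    simpa [mfld_simps] using h
  exact (h'.contMDiffAt ((isOpen_extend_target e).mem_nhds hz)).mdifferentiableAt (by simp)

theorem contDiffOn_comp_extend_symm (he : e ∈ atlas E M) {u : M → ℝ}
    (hu : IsScalar 𝓘(ℝ, E) u) :
    ContDiffOn ℝ ∞ (u ∘ (e.extend 𝓘(ℝ, E)).symm) (e.extend 𝓘(ℝ, E)).target := by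
  have h := contMDiffOn_extend_symm (I := 𝓘(ℝ, E)) (n := ∞)
    (IsManifold.subset_maximalAtlas (I := 𝓘(ℝ, E)) (n := ∞) he)
  have h' : ContMDiffOn 𝓘(ℝ, E) 𝓘(ℝ, E) ∞ (e.extend 𝓘(ℝ, E)).symm
      (e.extend 𝓘(ℝ, E)).target := by
    simpa [mfld_simps] using h
  exact (hu.comp_contMDiffOn h').contDiffOn

theorem bijective_mfderiv_extend_symm (he : e ∈ atlas E M) {z : E}
    (hz : z ∈ (e.extend 𝓘(ℝ, E)).target) :
    Function.Bijective (mfderiv 𝓘(ℝ, E) 𝓘(ℝ, E) (e.extend 𝓘(ℝ, E)).symm z) := by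
  have hd := mdifferentiable_of_mem_atlas (I := 𝓘(ℝ, E)) he
  have hz' : z ∈ e.target := by simpa [mfld_simps] using hz
  have := hd.symm.mfderiv_bijective (x := z) hz'
  exact this

/-- A vector in the left kernel of the Gram matrix gives, through `φ`, a vector orthogonal to
everything. It vanishes by nondegeneracy, and injectivity of `φ` and independence of `b` kill the
coefficients. -/
theorem det_ne_zero_of_nondegenerate (b : Basis ι ℝ E) {V : Type*} [AddCommGroup V] [Module ℝ V]
    (φ : E →ₗ[ℝ] V) (hφ : Function.Bijective φ) (B : LinearMap.BilinForm ℝ V)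
    (hB : ∀ u, (∀ v, B u v = 0) → u = 0) :
    (Matrix.of fun i j => B (φ (b i)) (φ (b j))).det ≠ 0 := by
  intro h0
  obtain ⟨v, hv, hv0⟩ := Matrix.exists_vecMul_eq_zero_iff.2 h0
  apply hv
  have hu : φ (∑ i, v i • b i) = 0 := by
    apply hB
    intro w
    obtain ⟨x, rfl⟩ := hφ.2 w
    rw [← b.sum_repr x]
    simp only [map_sum, map_smul, LinearMap.sum_apply, LinearMap.smul_apply, smul_eq_mul]
    refine Finset.sum_eq_zero fun j _ => ?_
    have := congrFun hv0 j
    simp only [Matrix.vecMul, dotProduct, Matrix.of_apply, Pi.zero_apply] at this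
    rw [this, mul_zero]
  have h1 : ∑ i, v i • b i = 0 := hφ.1 (by rw [hu, map_zero])
  exact funext (Fintype.linearIndependent_iff.1 b.linearIndependent v h1)

theorem IsSemiRiemannian.isMetricOn {b : Basis ι ℝ E} {g : FormField 𝓘(ℝ, E) M}
    (hg : IsSemiRiemannian 𝓘(ℝ, E) b g) (he : e ∈ atlas E M) :
    IsMetricOn (metricCoord 𝓘(ℝ, E) b g e) (e.extend 𝓘(ℝ, E)).target where
  isOpen := isOpen_extend_target e
  smooth := hg.smooth e he
  symm _ _ _ _ := hg.symm _ _ _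
  isUnit z hz := isUnit_iff_ne_zero.2 <|
    det_ne_zero_of_nondegenerate b (mfderiv 𝓘(ℝ, E) 𝓘(ℝ, E) (e.extend 𝓘(ℝ, E)).symm z).toLinearMap
      (bijective_mfderiv_extend_symm he hz) _ (hg.nondegenerate _)

/-- **Schur's lemma**: in dimension at least three, pointwise constant sectional curvature is
constant. -/
theorem HasPointwiseConstantCurvature.hasConstantCurvature [ConnectedSpace M] {b : Basis ι ℝ E}
    {g : FormField 𝓘(ℝ, E) M} (hg : IsSemiRiemannian 𝓘(ℝ, E) b g) (hι : 3 ≤ Fintype.card ι)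
    (h : HasPointwiseConstantCurvature 𝓘(ℝ, E) b g) : HasConstantCurvature 𝓘(ℝ, E) b g := by
  obtain ⟨μ, hμ, hR⟩ := h
  have hloc : IsLocallyConstant μ := by
    rw [IsLocallyConstant.iff_eventually_eq]
    intro y
    set e := chartAt E y
    have he : e ∈ atlas E M := chart_mem_atlas E y
    have hm := hg.isMetricOn he
    have hs := contDiffOn_comp_extend_symm he hμ
    have hz : ∀ z ∈ (e.extend 𝓘(ℝ, E)).target, fderiv ℝ (μ ∘ (e.extend 𝓘(ℝ, E)).symm) z = 0 := by
      intro z hz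
      refine ContinuousLinearMap.coe_injective (b.ext fun i => ?_)
      refine hm.schur b hι hs (fun w hw j k l n => ?_) hz i
      have hsrc : (e.extend 𝓘(ℝ, E)).symm w ∈ e.source := by
        simpa using (e.extend 𝓘(ℝ, E)).map_target hw
      have := hR e he _ hsrc j k l n
      rw [rAt, gAt, (e.extend 𝓘(ℝ, E)).right_inv hw] at this
      exact this
    have hy : y ∈ (e.extend 𝓘(ℝ, E)).source := by simp [e]
    -- A ball inside the chart image is connected, so the vanishing derivative makes `μ` constant on
    -- it and hence near `y`. Connectedness of `M` then makes `μ` constant globally.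
    obtain ⟨r, hr, hball⟩ := Metric.isOpen_iff.1 hm.isOpen _ ((e.extend 𝓘(ℝ, E)).map_source hy)
    have hsrc : e.source ∈ nhds y := e.open_source.mem_nhds (mem_chart_source E y)
    have hpre : ∀ᶠ y' in nhds y, e.extend 𝓘(ℝ, E) y' ∈ Metric.ball (e.extend 𝓘(ℝ, E) y) r :=
      (e.continuousAt_extend (mem_chart_source E y)).eventually (Metric.ball_mem_nhds _ hr)
    filter_upwards [hsrc, hpre] with y' h1 h2
    have hconst := Metric.isOpen_ball.is_const_of_fderiv_eq_zero
      (convex_ball (e.extend 𝓘(ℝ, E) y) r).isPreconnected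
      (f := μ ∘ (e.extend 𝓘(ℝ, E)).symm) (𝕜 := ℝ)
      ((hs.differentiableOn (by simp)).mono hball) (fun z hzb => hz z (hball hzb)) h2
      (Metric.mem_ball_self hr)
    simpa [h1, hy, e.extend_left_inv, mem_chart_source E y, e] using hconst
  obtain ⟨y₀⟩ : Nonempty M := inferInstance
  refine ⟨μ y₀, fun e he q hq i j k l => ?_⟩
  rw [hR e he q hq, hloc.apply_eq_of_isPreconnected isPreconnected_univ (Set.mem_univ q)
    (Set.mem_univ y₀)]

end Charts

/-! ### The warped product metric in product charts -/

section WarpedCharts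

variable {ι E B : Type*} [NormedAddCommGroup E] [NormedSpace ℝ E]
  [TopologicalSpace B] [ChartedSpace E B] [IsManifold 𝓘(ℝ, E) ∞ B]
  {ι' E' F : Type*} [NormedAddCommGroup E'] [NormedSpace ℝ E']
  [TopologicalSpace F] [ChartedSpace E' F] [IsManifold 𝓘(ℝ, E') ∞ F]
  {e : OpenPartialHomeomorph B E} {e' : OpenPartialHomeomorph F E'}

theorem mdifferentiableAt_prod_extend_symm (he : e ∈ atlas E B) (he' : e' ∈ atlas E' F)
    {z : E × E'} (hz : z ∈ (e.extend 𝓘(ℝ, E)).target ×ˢ (e'.extend 𝓘(ℝ, E')).target) :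
    MDifferentiableAt 𝓘(ℝ, E × E') (𝓘(ℝ, E).prod 𝓘(ℝ, E')) ((e.prod e').extend (𝓘(ℝ, E).prod 𝓘(ℝ, E'))).symm z := by
  have h1 := (mdifferentiableAt_extend_symm he hz.1).comp z
    (differentiableAt_fst (𝕜 := ℝ) (p := z)).mdifferentiableAt
  have h2 := (mdifferentiableAt_extend_symm he' hz.2).comp z
    (differentiableAt_snd (𝕜 := ℝ) (p := z)).mdifferentiableAt
  exact h1.prodMk h2

/-- Both sides are the derivative of one map, since the projection after the inverse product chart
is the inverse base chart after the projection. The chain rule is applied to each factorization. -/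
theorem mfderiv_fst_coordVec (he : e ∈ atlas E B) (he' : e' ∈ atlas E' F) {z : E × E'}
    (hz : z ∈ (e.extend 𝓘(ℝ, E)).target ×ˢ (e'.extend 𝓘(ℝ, E')).target) (v : E × E') :
    mfderiv (𝓘(ℝ, E).prod 𝓘(ℝ, E')) 𝓘(ℝ, E) (Prod.fst : B × F → B) (((e.prod e').extend (𝓘(ℝ, E).prod 𝓘(ℝ, E'))).symm z)
      (mfderiv 𝓘(ℝ, E × E') (𝓘(ℝ, E).prod 𝓘(ℝ, E')) ((e.prod e').extend (𝓘(ℝ, E).prod 𝓘(ℝ, E'))).symm z v)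
      = mfderiv 𝓘(ℝ, E) 𝓘(ℝ, E) (e.extend 𝓘(ℝ, E)).symm z.1 v.1 := by
  have h1 := mfderiv_comp (I := 𝓘(ℝ, E × E')) (I' := (𝓘(ℝ, E).prod 𝓘(ℝ, E'))) (I'' := 𝓘(ℝ, E)) z
    (g := (Prod.fst : B × F → B)) mdifferentiableAt_fst
    (mdifferentiableAt_prod_extend_symm he he' hz)
  have h2 := mfderiv_comp (I := 𝓘(ℝ, E × E')) (I' := 𝓘(ℝ, E)) (I'' := 𝓘(ℝ, E)) z
    (f := Prod.fst) (mdifferentiableAt_extend_symm he hz.1)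
    (differentiableAt_fst (𝕜 := ℝ) (p := z)).mdifferentiableAt
  have h3 : (Prod.fst : B × F → B) ∘ ((e.prod e').extend (𝓘(ℝ, E).prod 𝓘(ℝ, E'))).symm
      = (e.extend 𝓘(ℝ, E)).symm ∘ Prod.fst := rfl
  have h4 : mfderiv 𝓘(ℝ, E × E') 𝓘(ℝ, E) (Prod.fst : E × E' → E) z v = v.1 := by
    rw [mfderiv_eq_fderiv, fderiv_fst]; rfl
  rw [h3] at h1
  have h5 := congrArg (fun L => L v) (h1.symm.trans h2)
  refine h5.trans ?_
  change mfderiv 𝓘(ℝ, E) 𝓘(ℝ, E) (e.extend 𝓘(ℝ, E)).symm z.1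
    (mfderiv 𝓘(ℝ, E × E') 𝓘(ℝ, E) (Prod.fst : E × E' → E) z v) = _
  rw [h4]

theorem mfderiv_snd_coordVec (he : e ∈ atlas E B) (he' : e' ∈ atlas E' F) {z : E × E'}
    (hz : z ∈ (e.extend 𝓘(ℝ, E)).target ×ˢ (e'.extend 𝓘(ℝ, E')).target) (v : E × E') :
    mfderiv (𝓘(ℝ, E).prod 𝓘(ℝ, E')) 𝓘(ℝ, E') (Prod.snd : B × F → F) (((e.prod e').extend (𝓘(ℝ, E).prod 𝓘(ℝ, E'))).symm z)
      (mfderiv 𝓘(ℝ, E × E') (𝓘(ℝ, E).prod 𝓘(ℝ, E')) ((e.prod e').extend (𝓘(ℝ, E).prod 𝓘(ℝ, E'))).symm z v)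
      = mfderiv 𝓘(ℝ, E') 𝓘(ℝ, E') (e'.extend 𝓘(ℝ, E')).symm z.2 v.2 := by
  have h1 := mfderiv_comp (I := 𝓘(ℝ, E × E')) (I' := (𝓘(ℝ, E).prod 𝓘(ℝ, E'))) (I'' := 𝓘(ℝ, E')) z
    (g := (Prod.snd : B × F → F)) mdifferentiableAt_snd
    (mdifferentiableAt_prod_extend_symm he he' hz)
  have h2 := mfderiv_comp (I := 𝓘(ℝ, E × E')) (I' := 𝓘(ℝ, E')) (I'' := 𝓘(ℝ, E')) z
    (f := Prod.snd) (mdifferentiableAt_extend_symm he' hz.2)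
    (differentiableAt_snd (𝕜 := ℝ) (p := z)).mdifferentiableAt
  have h3 : (Prod.snd : B × F → F) ∘ ((e.prod e').extend (𝓘(ℝ, E).prod 𝓘(ℝ, E'))).symm
      = (e'.extend 𝓘(ℝ, E')).symm ∘ Prod.snd := rfl
  have h4 : mfderiv 𝓘(ℝ, E × E') 𝓘(ℝ, E') (Prod.snd : E × E' → E') z v = v.2 := by
    rw [mfderiv_eq_fderiv, fderiv_snd]; rfl
  rw [h3] at h1
  have h5 := congrArg (fun L => L v) (h1.symm.trans h2)
  refine h5.trans ?_
  change mfderiv 𝓘(ℝ, E') 𝓘(ℝ, E') (e'.extend 𝓘(ℝ, E')).symm z.2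
    (mfderiv 𝓘(ℝ, E × E') 𝓘(ℝ, E') (Prod.snd : E × E' → E') z v) = _
  rw [h4]

/-- Each vector of the product basis has one zero component. Hence one of the two pulled-back forms
vanishes on it, and both vanish on mixed pairs. -/
theorem metricCoord_warpedMetric (b : Basis ι ℝ E) (b' : Basis ι' ℝ E')
    (gB : FormField 𝓘(ℝ, E) B) (gF : FormField 𝓘(ℝ, E') F) (f : B → ℝ) (he : e ∈ atlas E B)
    (he' : e' ∈ atlas E' F) {z : E × E'}
    (hz : z ∈ (e.extend 𝓘(ℝ, E)).target ×ˢ (e'.extend 𝓘(ℝ, E')).target) :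
    metricCoord (𝓘(ℝ, E).prod 𝓘(ℝ, E')) (b.prod b') (warpedMetric 𝓘(ℝ, E) 𝓘(ℝ, E') gB gF f) (e.prod e') z
      = blockMetric (metricCoord 𝓘(ℝ, E) b gB e) (metricCoord 𝓘(ℝ, E') b' gF e')
          (f ∘ (e.extend 𝓘(ℝ, E)).symm) z := by
  have key : ∀ u v : E × E', warpedMetric 𝓘(ℝ, E) 𝓘(ℝ, E') gB gF f
      (((e.prod e').extend (𝓘(ℝ, E).prod 𝓘(ℝ, E'))).symm z)
      (mfderiv 𝓘(ℝ, E × E') (𝓘(ℝ, E).prod 𝓘(ℝ, E')) ((e.prod e').extend (𝓘(ℝ, E).prod 𝓘(ℝ, E'))).symm z u)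
      (mfderiv 𝓘(ℝ, E × E') (𝓘(ℝ, E).prod 𝓘(ℝ, E')) ((e.prod e').extend (𝓘(ℝ, E).prod 𝓘(ℝ, E'))).symm z v)
      = gB ((e.extend 𝓘(ℝ, E)).symm z.1)
          (mfderiv 𝓘(ℝ, E) 𝓘(ℝ, E) (e.extend 𝓘(ℝ, E)).symm z.1 u.1)
          (mfderiv 𝓘(ℝ, E) 𝓘(ℝ, E) (e.extend 𝓘(ℝ, E)).symm z.1 v.1)
        + f ((e.extend 𝓘(ℝ, E)).symm z.1) * gF ((e'.extend 𝓘(ℝ, E')).symm z.2)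
          (mfderiv 𝓘(ℝ, E') 𝓘(ℝ, E') (e'.extend 𝓘(ℝ, E')).symm z.2 u.2)
          (mfderiv 𝓘(ℝ, E') 𝓘(ℝ, E') (e'.extend 𝓘(ℝ, E')).symm z.2 v.2) := by
    intro u v
    rw [← mfderiv_fst_coordVec he he' hz u, ← mfderiv_fst_coordVec he he' hz v,
      ← mfderiv_snd_coordVec he he' hz u, ← mfderiv_snd_coordVec he he' hz v]
    rfl
  ext i j
  refine (key _ _).trans ?_
  have h0 : mfderiv 𝓘(ℝ, E) 𝓘(ℝ, E) (e.extend 𝓘(ℝ, E)).symm z.1 (0 : E) = 0 := map_zero _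
  have h0' : mfderiv 𝓘(ℝ, E') 𝓘(ℝ, E') (e'.extend 𝓘(ℝ, E')).symm z.2 (0 : E') = 0 :=
    map_zero _
  rcases i with i | i <;> rcases j with j | j <;>
    simp only [Basis.prod_apply_inl_fst, Basis.prod_apply_inl_snd, Basis.prod_apply_inr_fst,
      Basis.prod_apply_inr_snd, h0, h0', map_zero, LinearMap.zero_apply, mul_zero, add_zero,
      zero_add] <;> rfl

end WarpedCharts

/-! ### Algebra of Kulkarni–Nomizu products and traces -/

section TensorAlgebra

/-- Expansion of a generalized Roter type expression in `A = u S + v G` and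
`A² = u² S² + 2 u v S + v² G`. -/
theorem kn_affine {ι : Type*} {G S S2 A A2 : Matrix ι ι ℝ} {u v : ℝ} (hA : A = u • S + v • G)
    (hA2 : A2 = u ^ 2 • S2 + (2 * u * v) • S + v ^ 2 • G) (L₁ L₂ L₃ L₄ L₅ L₆ : ℝ)
    (i j k l : ι) :
    L₁ * kn G G i j k l + L₂ * kn G A i j k l + L₃ * kn A A i j k l + L₄ * kn G A2 i j k l
      + L₅ * kn A A2 i j k l + L₆ * kn A2 A2 i j k l =
    (L₁ + v * L₂ + v ^ 2 * L₃ + v ^ 2 * L₄ + v ^ 3 * L₅ + v ^ 4 * L₆) * kn G G i j k l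
      + (u * L₂ + 2 * u * v * L₃ + 2 * u * v * L₄ + 3 * u * v ^ 2 * L₅ + 4 * u * v ^ 3 * L₆)
        * kn G S i j k l
      + (u ^ 2 * L₃ + 2 * u ^ 2 * v * L₅ + 4 * u ^ 2 * v ^ 2 * L₆) * kn S S i j k l
      + (u ^ 2 * L₄ + u ^ 2 * v * L₅ + 2 * u ^ 2 * v ^ 2 * L₆) * kn G S2 i j k l
      + (u ^ 3 * L₅ + 4 * u ^ 3 * v * L₆) * kn S S2 i j k l
      + u ^ 4 * L₆ * kn S2 S2 i j k l := by
  subst hA hA2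
  simp only [kn, Matrix.add_apply, Matrix.smul_apply, smul_eq_mul]
  ring

/-- A generalized Roter type expression when `S² = a S + e G`. -/
theorem kn_of_quadratic {ι : Type*} {G S S2 : Matrix ι ι ℝ} {a e : ℝ} (h : S2 = a • S + e • G)
    (L₁ L₂ L₃ L₄ L₅ L₆ : ℝ) (i j k l : ι) :
    L₁ * kn G G i j k l + L₂ * kn G S i j k l + L₃ * kn S S i j k l + L₄ * kn G S2 i j k l
      + L₅ * kn S S2 i j k l + L₆ * kn S2 S2 i j k l =
    (L₁ + e * L₄ + e ^ 2 * L₆) * kn G G i j k l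
      + (L₂ + a * L₄ + e * L₅ + 2 * a * e * L₆) * kn G S i j k l
      + (L₃ + a * L₅ + a ^ 2 * L₆) * kn S S i j k l := by
  subst h
  simp only [kn, Matrix.add_apply, Matrix.smul_apply, smul_eq_mul]
  ring

variable {ι : Type*} [Fintype ι] [DecidableEq ι] {G : Matrix ι ι ℝ}

theorem comp_eq_mul (G A B : Matrix ι ι ℝ) : comp G A B = A * G⁻¹ * B := by
  ext i j
  simp only [comp, Matrix.of_apply, Matrix.mul_apply, Finset.sum_mul]
  rw [Finset.sum_comm]
  exact Finset.sum_congr rfl fun _ _ => Finset.sum_congr rfl fun _ _ => by ring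

/-- `comp G` is the matrix product with `G⁻¹` inserted, so `G` is its unit and this is a binomial
square. It supplies the second hypothesis of `kn_affine`. -/
theorem comp_affine (hG : IsUnit G.det) (S : Matrix ι ι ℝ) (u v : ℝ) :
    comp G (u • S + v • G) (u • S + v • G)
      = u ^ 2 • comp G S S + (2 * u * v) • S + v ^ 2 • G := by
  have h1 := Matrix.mul_nonsing_inv _ hG
  have h2 := Matrix.nonsing_inv_mul _ hG
  have h3 : S * G⁻¹ * G = S := by rw [mul_assoc, h2, mul_one]
  simp only [comp_eq_mul, add_mul, mul_add, smul_mul_assoc, mul_smul_comm, h1, h3, one_mul]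
  module

theorem tr_add (G A B : Matrix ι ι ℝ) : tr G (A + B) = tr G A + tr G B := by
  simp [tr, mul_add, Finset.sum_add_distrib]

theorem tr_smul (G A : Matrix ι ι ℝ) (c : ℝ) : tr G (c • A) = c * tr G A := by
  simp only [tr, Finset.mul_sum, Matrix.smul_apply, smul_eq_mul]
  exact Finset.sum_congr rfl fun _ _ => Finset.sum_congr rfl fun _ _ => by ring

theorem tr_self (hG : IsUnit G.det) (hsymm : ∀ i j, G i j = G j i) :
    tr G G = Fintype.card ι := by
  have h2 := Matrix.nonsing_inv_mul _ hG
  have : ∀ i, ∑ j, G⁻¹ i j * G i j = 1 := by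
    intro i
    have h3 := congrFun (congrFun h2 i) i
    rw [Matrix.mul_apply, Matrix.one_apply_eq] at h3
    rw [← h3]
    exact Finset.sum_congr rfl fun j _ => by rw [hsymm]
  simp [tr, this]

theorem tr_comp_add_smul (G S T : Matrix ι ι ℝ) (c : ℝ) :
    tr G (comp G (S + c • T) (S + c • T))
      = c * (c * tr G (comp G T T) + tr G (symProd G S T)) + tr G (comp G S S) := by
  simp only [symProd, comp_eq_mul, add_mul, mul_add, smul_mul_assoc, mul_smul_comm, tr_add,
    tr_smul]
  ring

theorem kn_contract (hG : IsUnit G.det) (hsymm : ∀ i j, G i j = G j i) (A : Matrix ι ι ℝ)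
    (j k : ι) : ∑ i, ∑ l, G⁻¹ i l * kn G A i j k l
      = ((Fintype.card ι : ℝ) - 2) * A j k + tr G A * G j k := by
  have h1 := Matrix.mul_nonsing_inv _ hG
  have h2 := Matrix.nonsing_inv_mul _ hG
  have e1 : ∑ i, ∑ l, G⁻¹ i l * (G i k * A j l) = A j k := by
    rw [Finset.sum_comm]
    have : ∀ l, ∑ i, G⁻¹ i l * (G i k * A j l) = (G * G⁻¹) k l * A j l := by
      intro l
      rw [Matrix.mul_apply, Finset.sum_mul]
      exact Finset.sum_congr rfl fun i _ => by rw [hsymm i k]; ring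
    simp [this, h1, Matrix.one_apply]
  have e2 : ∑ i, ∑ l, G⁻¹ i l * (G j l * A i k) = A j k := by
    have : ∀ i, ∑ l, G⁻¹ i l * (G j l * A i k) = (G⁻¹ * G) i j * A i k := by
      intro i
      rw [Matrix.mul_apply, Finset.sum_mul]
      exact Finset.sum_congr rfl fun l _ => by rw [hsymm j l]; ring
    simp [this, h2, Matrix.one_apply]
  have e3 : ∑ i, ∑ l, G⁻¹ i l * (G i l * A j k) = Fintype.card ι * A j k := by
    rw [← tr_self hG hsymm, tr, Finset.sum_mul]
    simp only [Finset.sum_mul, mul_assoc]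
  have e4 : ∑ i, ∑ l, G⁻¹ i l * (G j k * A i l) = tr G A * G j k := by
    rw [tr, Finset.sum_mul]
    simp only [Finset.sum_mul]
    exact Finset.sum_congr rfl fun _ _ => Finset.sum_congr rfl fun _ _ => by ring
  simp only [kn, mul_add, mul_sub, Finset.sum_add_distrib, Finset.sum_sub_distrib, e1, e2, e3, e4]
  ring

/-- An algebraic curvature tensor of the form `N₁ g∧g + N₂ g∧S`, `S` being its Ricci tensor, has
vanishing Weyl tensor. -/
theorem weyl_eq_zero (hG : IsUnit G.det) (hsymm : ∀ i j, G i j = G j i)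
    (hι : 3 ≤ Fintype.card ι) {R : ι → ι → ι → ι → ℝ} {S : Matrix ι ι ℝ}
    (hS : ∀ j k, S j k = ∑ i, ∑ l, G⁻¹ i l * R i j k l) {N₁ N₂ : ℝ}
    (hR : ∀ i j k l, R i j k l = N₁ * kn G G i j k l + N₂ * kn G S i j k l) (i j k l : ι) :
    R i j k l - 1 / ((Fintype.card ι : ℝ) - 2) * kn G S i j k l
      + tr G S / (2 * ((Fintype.card ι : ℝ) - 1) * ((Fintype.card ι : ℝ) - 2))
        * kn G G i j k l = 0 := by
  have hd : (3 : ℝ) ≤ Fintype.card ι := by exact_mod_cast hι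
  set d : ℝ := (Fintype.card ι : ℝ) with hd_def
  have hd2 : d - 2 ≠ 0 := by linarith
  have hd1 : d - 1 ≠ 0 := by linarith
  set κ := tr G S with hκ
  -- Contracting the assumed form of `R` relates `S` to `G`. Either `N₂ = 1/(d-2)` and the trace
  -- fixes `N₁`, or `S` is proportional to `G`. The closing linear combination of `hkn` and `htr`
  -- covers both cases without a split.
  have hric : (1 - N₂ * (d - 2)) • S = (2 * (d - 1) * N₁ + N₂ * κ) • G := by
    ext j k
    have h1 : S j k = N₁ * ∑ i, ∑ l, G⁻¹ i l * kn G G i j k l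
        + N₂ * ∑ i, ∑ l, G⁻¹ i l * kn G S i j k l := by
      rw [hS j k]
      simp only [hR, Finset.mul_sum, ← Finset.sum_add_distrib]
      exact Finset.sum_congr rfl fun _ _ => Finset.sum_congr rfl fun _ _ => by ring
    rw [kn_contract hG hsymm, kn_contract hG hsymm, tr_self hG hsymm] at h1
    simp only [Matrix.smul_apply, smul_eq_mul]
    linear_combination h1
  have htr : (1 - N₂ * (d - 2)) * κ = (2 * (d - 1) * N₁ + N₂ * κ) * d := by
    have := congrArg (tr G) hric
    rwa [tr_smul, tr_smul, tr_self hG hsymm] at this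
  have hkn : (1 - N₂ * (d - 2)) * kn G S i j k l
      = (2 * (d - 1) * N₁ + N₂ * κ) * kn G G i j k l := by
    have hp : ∀ a b, (1 - N₂ * (d - 2)) * S a b = (2 * (d - 1) * N₁ + N₂ * κ) * G a b :=
      fun a b => congrFun (congrFun hric a) b
    simp only [kn]
    linear_combination G i l * hp j k + G j k * hp i l - G i k * hp j l - G j l * hp i k
  rw [hR]
  field_simp
  linear_combination -(2 * (d - 1)) * hkn + kn G G i j k l * htr

end TensorAlgebra

/-! ### Consequences of the generalized Roter type condition in product coordinates -/

section WarpedRoter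

open Sum

variable {ι E : Type*} [Fintype ι] [DecidableEq ι] [NormedAddCommGroup E] [NormedSpace ℝ E]
  {ι' E' : Type*} [Fintype ι'] [DecidableEq ι'] [NormedAddCommGroup E'] [NormedSpace ℝ E']
  {g : E → Matrix ι ι ℝ} {s : Set E} {g' : E' → Matrix ι' ι' ℝ} {t : Set E'} {f : E → ℝ}
  {z : E × E'}

/-- The generalized Roter type condition at a point, in coordinates. -/
def IsGRTAt (b : Basis ι ℝ E) (g : E → Matrix ι ι ℝ) (z : E) (L₁ L₂ L₃ L₄ L₅ L₆ : ℝ) : Prop :=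
  ∀ i j k l : ι, riem b g z i j k l =
    L₁ * kn (g z) (g z) i j k l
      + L₂ * kn (g z) (ricci b g z) i j k l
      + L₃ * kn (ricci b g z) (ricci b g z) i j k l
      + L₄ * kn (g z) (comp (g z) (ricci b g z) (ricci b g z)) i j k l
      + L₅ * kn (ricci b g z) (comp (g z) (ricci b g z) (ricci b g z)) i j k l
      + L₆ * kn (comp (g z) (ricci b g z) (ricci b g z))
          (comp (g z) (ricci b g z) (ricci b g z)) i j k l

/-- The scalar `Q` in coordinates. -/
def coordQ (b : Basis ι ℝ E) (g : E → Matrix ι ι ℝ) (f : E → ℝ) (m : ℕ) (x : E) : ℝ :=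
  f x * (tr (g x) (tensorT b g f x) - ((m : ℝ) - 1) * scalarP b g f x)

namespace IsWarpedOn

theorem ricci_eq_fromBlocks (H : IsWarpedOn g s g' t f) (b : Basis ι ℝ E) (b' : Basis ι' ℝ E')
    (hz : z ∈ s ×ˢ t) : ricci (b.prod b') (blockMetric g g' f) z
      = Matrix.fromBlocks (ricci b g z.1 + (Fintype.card ι' : ℝ) • tensorT b g f z.1) 0 0
          (ricci b' g' z.2 + coordQ b g f (Fintype.card ι') z.1 • g' z.2) := by
  ext i j
  rcases i with i | i <;> rcases j with j | j
  · simp [H.ricci_base b b' hz]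
  · simp [H.ricci_mixed b b' hz]
  · simp [H.ricci_mixed' b b' hz]
  · simp [H.ricci_fiber b b' hz, coordQ]

/-- The fiber block of the inverse metric is `f⁻¹ g̃⁻¹`, whence the factor on the second block. It
is the source of the powers of `φ⁻¹` in the fiber coefficients. -/
theorem comp_fromBlocks (H : IsWarpedOn g s g' t f) (hz : z ∈ s ×ˢ t) (A : Matrix ι ι ℝ)
    (X : Matrix ι' ι' ℝ) :
    comp (blockMetric g g' f z) (Matrix.fromBlocks A 0 0 X) (Matrix.fromBlocks A 0 0 X)
      = Matrix.fromBlocks (comp (g z.1) A A) 0 0 ((f z.1)⁻¹ • comp (g' z.2) X X) := by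
  simp [comp_eq_mul, H.inv_blockMetric hz, Matrix.fromBlocks_multiply]

variable {L₁ L₂ L₃ L₄ L₅ L₆ : ℝ}

theorem isGRTAt_base (H : IsWarpedOn g s g' t f) (b : Basis ι ℝ E) (b' : Basis ι' ℝ E')
    (hz : z ∈ s ×ˢ t)
    (hR : IsGRTAt (b.prod b') (blockMetric g g' f) z L₁ L₂ L₃ L₄ L₅ L₆) {u v : ℝ}
    (hT : ricci b g z.1 + (Fintype.card ι' : ℝ) • tensorT b g f z.1
      = u • ricci b g z.1 + v • g z.1) :
    IsGRTAt b g z.1 (L₁ + v * L₂ + v ^ 2 * L₃ + v ^ 2 * L₄ + v ^ 3 * L₅ + v ^ 4 * L₆)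
      (u * L₂ + 2 * u * v * L₃ + 2 * u * v * L₄ + 3 * u * v ^ 2 * L₅ + 4 * u * v ^ 3 * L₆)
      (u ^ 2 * L₃ + 2 * u ^ 2 * v * L₅ + 4 * u ^ 2 * v ^ 2 * L₆)
      (u ^ 2 * L₄ + u ^ 2 * v * L₅ + 2 * u ^ 2 * v ^ 2 * L₆)
      (u ^ 3 * L₅ + 4 * u ^ 3 * v * L₆) (u ^ 4 * L₆) := by
  intro i j k l
  have h := hR (inl i) (inl j) (inl k) (inl l)
  rw [H.riem_base b b' hz, H.ricci_eq_fromBlocks b b' hz, H.comp_fromBlocks hz] at h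
  have hA2 := comp_affine (H.base.isUnit _ hz.1) (ricci b g z.1) u v
  rw [← hT] at hA2
  rw [h, ← kn_affine hT hA2]
  simp [kn, blockMetric]

/-- The coefficients come from `kn_affine` with `u = 1`, `v = Q`, after the factors `φ` of the
metric and `φ⁻¹` of the level-two block are absorbed into the `Lᵢ`. The Gauss term `φ² P · ½ g̃∧g̃`
joins `L₁`, and the outer `φ⁻¹` divides out the factor of `R̃`. -/
theorem isGRTAt_fiber (H : IsWarpedOn g s g' t f) (b : Basis ι ℝ E) (b' : Basis ι' ℝ E')
    (hz : z ∈ s ×ˢ t)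
    (hR : IsGRTAt (b.prod b') (blockMetric g g' f) z L₁ L₂ L₃ L₄ L₅ L₆) {φ P Q : ℝ}
    (hφ : φ = f z.1) (hP : P = scalarP b g f z.1)
    (hQ : Q = coordQ b g f (Fintype.card ι') z.1) :
    IsGRTAt b' g' z.2
      (φ⁻¹ * (φ ^ 2 * (L₁ + 1 / 2 * P) + Q * (φ * L₂) + Q ^ 2 * L₃ + Q ^ 2 * L₄
        + Q ^ 3 * (φ⁻¹ * L₅) + Q ^ 4 * (φ⁻¹ ^ 2 * L₆)))
      (φ⁻¹ * (φ * L₂ + 2 * Q * L₃ + 2 * Q * L₄ + 3 * Q ^ 2 * (φ⁻¹ * L₅)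
        + 4 * Q ^ 3 * (φ⁻¹ ^ 2 * L₆)))
      (φ⁻¹ * (L₃ + 2 * Q * (φ⁻¹ * L₅) + 4 * Q ^ 2 * (φ⁻¹ ^ 2 * L₆)))
      (φ⁻¹ * (L₄ + Q * (φ⁻¹ * L₅) + 2 * Q ^ 2 * (φ⁻¹ ^ 2 * L₆)))
      (φ⁻¹ * (φ⁻¹ * L₅ + 4 * Q * (φ⁻¹ ^ 2 * L₆)))
      (φ⁻¹ * (φ⁻¹ ^ 2 * L₆)) := by
  intro i j k l
  have hφ0 : φ ≠ 0 := hφ ▸ H.ne_zero z.1 hz.1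
  have h := hR (inr i) (inr j) (inr k) (inr l)
  rw [H.riem_fiber b b' hz, H.ricci_eq_fromBlocks b b' hz, H.comp_fromBlocks hz] at h
  rw [← hφ, ← hP, ← hQ] at h
  have hX : ricci b' g' z.2 + Q • g' z.2 = (1 : ℝ) • ricci b' g' z.2 + Q • g' z.2 := by
    rw [one_smul]
  have hX2 := comp_affine (H.fiber.isUnit _ hz.2) (ricci b' g' z.2) 1 Q
  rw [← hX] at hX2
  have key := kn_affine hX hX2 (φ ^ 2 * (L₁ + 1 / 2 * P)) (φ * L₂) L₃ L₄ (φ⁻¹ * L₅)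
    (φ⁻¹ ^ 2 * L₆) i j k l
  set X := ricci b' g' z.2 + Q • g' z.2
  have h' : φ * riem b' g' z.2 i j k l
      = φ ^ 2 * (L₁ + 1 / 2 * P) * kn (g' z.2) (g' z.2) i j k l
        + φ * L₂ * kn (g' z.2) X i j k l + L₃ * kn X X i j k l
        + L₄ * kn (g' z.2) (comp (g' z.2) X X) i j k l
        + φ⁻¹ * L₅ * kn X (comp (g' z.2) X X) i j k l
        + φ⁻¹ ^ 2 * L₆ * kn (comp (g' z.2) X X) (comp (g' z.2) X X) i j k l := by
    rw [sub_eq_iff_eq_add] at h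
    rw [h]
    simp only [kn, blockMetric, Matrix.fromBlocks_apply₂₂, Matrix.smul_apply, smul_eq_mul, ← hφ]
    field_simp
    ring
  rw [← mul_right_inj' hφ0, h', key]
  simp only [one_pow, one_mul, mul_one]
  have hi : ∀ x, φ * (φ⁻¹ * x) = x := fun x => mul_inv_cancel_left₀ hφ0 x
  simp only [mul_add φ, mul_assoc φ⁻¹, hi]

/-- For fixed `β`, `γ` the mixed block of the Roter identity is an equation between base tensors: a
multiple of `T` equals a combination of `g`, `A = S̄ + m T` and `A²`. Their traces are `τ`, `p`, `ρ`
and `Θ`. Tracing leaves a relation among `S̃²`, `S̃`, `g̃`, whose first two coefficients are `-J₁`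
and `-J₂`. -/
theorem fiber_relation (H : IsWarpedOn g s g' t f) (b : Basis ι ℝ E) (b' : Basis ι' ℝ E')
    (hz : z ∈ s ×ˢ t)
    (hR : IsGRTAt (b.prod b') (blockMetric g g' f) z L₁ L₂ L₃ L₄ L₅ L₆) {φ Q τ ρ Θ : ℝ}
    (hφ : φ = f z.1) (hQ : Q = coordQ b g f (Fintype.card ι') z.1)
    (hτ : τ = tr (g z.1) (tensorT b g f z.1))
    (hρ : ρ = tr (g z.1) (ricci b g z.1) + (Fintype.card ι' : ℝ) * τ)
    (hΘ : Θ = (Fintype.card ι' : ℝ) * ((Fintype.card ι' : ℝ) *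
        tr (g z.1) (comp (g z.1) (tensorT b g f z.1) (tensorT b g f z.1))
        + tr (g z.1) (symProd (g z.1) (ricci b g z.1) (tensorT b g f z.1)))
      + tr (g z.1) (comp (g z.1) (ricci b g z.1) (ricci b g z.1))) :
    (φ⁻¹ * (L₄ * Fintype.card ι + L₅ * ρ + 2 * L₆ * Θ)) •
        comp (g' z.2) (ricci b' g' z.2) (ricci b' g' z.2)
      + (L₂ * Fintype.card ι + 2 * L₃ * ρ + L₅ * Θ
          + 2 * Q * φ⁻¹ * (L₄ * Fintype.card ι + L₅ * ρ + 2 * L₆ * Θ)) • ricci b' g' z.2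
      + (2 * L₁ * Fintype.card ι * φ + L₂ * (Fintype.card ι * Q + ρ * φ) + 2 * L₃ * ρ * Q
          + L₄ * Θ * φ + L₅ * Θ * Q
          + Q ^ 2 * φ⁻¹ * (L₄ * Fintype.card ι + L₅ * ρ + 2 * L₆ * Θ) - φ * τ) • g' z.2 = 0 := by
  have hX2 := comp_affine (H.fiber.isUnit _ hz.2) (ricci b' g' z.2) 1 Q
  rw [one_smul] at hX2
  set X := ricci b' g' z.2 + Q • g' z.2 with hX
  set A := ricci b g z.1 + (Fintype.card ι' : ℝ) • tensorT b g f z.1 with hA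
  set X2 := comp (g' z.2) X X with hX2_def
  set A2 := comp (g z.1) A A with hA2
  have htrA : tr (g z.1) A = ρ := by rw [hA, tr_add, tr_smul, hρ, hτ]
  have htrA2 : tr (g z.1) A2 = Θ := by rw [hA2, hA, tr_comp_add_smul, hΘ]
  ext β γ
  have hmat : (φ * g' z.2 β γ) • tensorT b g f z.1
      = (2 * L₁ * φ * g' z.2 β γ + L₂ * X β γ + L₄ * φ⁻¹ * X2 β γ) • g z.1
        + (L₂ * φ * g' z.2 β γ + 2 * L₃ * X β γ + L₅ * φ⁻¹ * X2 β γ) • A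
        + (L₄ * φ * g' z.2 β γ + L₅ * X β γ + 2 * L₆ * φ⁻¹ * X2 β γ) • A2 := by
    ext a d
    have h := hR (inl a) (inr β) (inr γ) (inl d)
    rw [H.riem_base_fiber_fiber_base b b' hz, H.ricci_eq_fromBlocks b b' hz,
      H.comp_fromBlocks hz, ← hφ, ← hQ] at h
    simp only [kn, blockMetric, Matrix.fromBlocks_apply₁₁, Matrix.fromBlocks_apply₂₂,
      Matrix.fromBlocks_apply₁₂, Matrix.fromBlocks_apply₂₁, Matrix.zero_apply,
      Matrix.smul_apply, smul_eq_mul, ← hφ, ← hA, ← hX, ← hA2, ← hX2_def] at h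
    simp only [Matrix.add_apply, Matrix.smul_apply, smul_eq_mul]
    linear_combination h
  have htr := congrArg (tr (g z.1)) hmat
  simp only [tr_add, tr_smul, htrA, htrA2, ← hτ,
    tr_self (H.base.isUnit _ hz.1) (H.base.symm _ hz.1)] at htr
  have e1 : X β γ = ricci b' g' z.2 β γ + Q * g' z.2 β γ := rfl
  have e2 : X2 β γ = comp (g' z.2) (ricci b' g' z.2) (ricci b' g' z.2) β γ
      + 2 * Q * ricci b' g' z.2 β γ + Q ^ 2 * g' z.2 β γ := by
    rw [hX2]; simp
  rw [e1, e2] at htr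
  simp only [Matrix.add_apply, Matrix.smul_apply, smul_eq_mul, Matrix.zero_apply]
  linear_combination -htr

end IsWarpedOn

end WarpedRoter

/-! ### Smooth scalars -/

section Scalars

variable {E H M : Type*} [NormedAddCommGroup E] [NormedSpace ℝ E] [TopologicalSpace H]
  [TopologicalSpace M] [ChartedSpace H M] {I : ModelWithCorners ℝ E H} {u v : M → ℝ}

namespace IsScalar

theorem const (c : ℝ) : IsScalar I (fun _ : M => c) := contMDiff_const

theorem add (hu : IsScalar I u) (hv : IsScalar I v) : IsScalar I fun q => u q + v q :=
  contDiff_add.comp_contMDiff (hu.prodMk_space hv)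

theorem sub (hu : IsScalar I u) (hv : IsScalar I v) : IsScalar I fun q => u q - v q :=
  (contDiff_fst.sub contDiff_snd).comp_contMDiff (hu.prodMk_space hv)

theorem mul (hu : IsScalar I u) (hv : IsScalar I v) : IsScalar I fun q => u q * v q :=
  (contDiff_fst.mul contDiff_snd).comp_contMDiff (hu.prodMk_space hv)

theorem neg (hu : IsScalar I u) : IsScalar I fun q => -u q :=
  contDiff_neg.comp_contMDiff hu

theorem pow (hu : IsScalar I u) (n : ℕ) : IsScalar I fun q => u q ^ n :=
  (contDiff_id.pow n).comp_contMDiff hu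

theorem inv (hu : IsScalar I u) (h : ∀ q, u q ≠ 0) : IsScalar I fun q => (u q)⁻¹ := fun q =>
  (contDiffAt_inv ℝ (h q)).comp_contMDiffAt (hu q)

end IsScalar

end Scalars

/-! ### Warped products of generalized Roter type -/

section ProductCharts

variable {E B E' F : Type*} [NormedAddCommGroup E] [NormedSpace ℝ E] [TopologicalSpace B]
  [NormedAddCommGroup E'] [NormedSpace ℝ E'] [TopologicalSpace F]

theorem extend_prod_mem_target {e : OpenPartialHomeomorph B E}
    {e' : OpenPartialHomeomorph F E'} {x : B} {y : F} (hx : x ∈ e.source) (hy : y ∈ e'.source) :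
    (e.extend 𝓘(ℝ, E) x, e'.extend 𝓘(ℝ, E') y) ∈
      (e.extend 𝓘(ℝ, E)).target ×ˢ (e'.extend 𝓘(ℝ, E')).target :=
  ⟨(e.extend 𝓘(ℝ, E)).map_source (by simpa using hx),
    (e'.extend 𝓘(ℝ, E')).map_source (by simpa using hy)⟩

variable [ChartedSpace E B] [ChartedSpace E' F]

theorem IsScalar.section_right {L : B × F → ℝ} (hL : IsScalar (𝓘(ℝ, E).prod 𝓘(ℝ, E')) L) (x : B) :
    IsScalar 𝓘(ℝ, E') fun y => L (x, y) :=
  ContMDiff.comp hL (contMDiff_const.prodMk contMDiff_id)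

theorem IsScalar.section_left {L : B × F → ℝ} (hL : IsScalar (𝓘(ℝ, E).prod 𝓘(ℝ, E')) L) (y : F) :
    IsScalar 𝓘(ℝ, E) fun x => L (x, y) :=
  ContMDiff.comp hL (contMDiff_id.prodMk contMDiff_const)

end ProductCharts

/-! ### Reducing the form of the fiber curvature by a quadratic relation -/

section Reduction

variable {ι' E' F : Type*} [Fintype ι'] [DecidableEq ι'] [NormedAddCommGroup E'] [NormedSpace ℝ E']
  [TopologicalSpace F] [ChartedSpace E' F] {b' : Basis ι' ℝ E'} {gF : FormField 𝓘(ℝ, E') F}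

/-- With at most one index `g∧g` vanishes, so `R = 0` and any constant serves. -/
theorem hasConstantCurvature_of_subsingleton [Subsingleton ι']
    (h : HasPointwiseConstantCurvature 𝓘(ℝ, E') b' gF) :
    HasConstantCurvature 𝓘(ℝ, E') b' gF := by
  obtain ⟨μ, -, hμ⟩ := h
  refine ⟨0, fun e he q hq i j k l => ?_⟩
  rw [hμ e he q hq, Subsingleton.elim j i, Subsingleton.elim k i, Subsingleton.elim l i,
    half_kn_self]
  ring

/-- On a generalized Roter type manifold with `S² = a S + c g`, the curvature tensor reduces to
Roter form. -/
theorem IsGRTWith.reduce {M₁ M₂ M₃ M₄ M₅ M₆ a c : F → ℝ}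
    (hM : IsGRTWith 𝓘(ℝ, E') b' gF M₁ M₂ M₃ M₄ M₅ M₆)
    (h : ∀ e ∈ atlas E' F, ∀ q ∈ e.source, s2At 𝓘(ℝ, E') b' gF e q
      = a q • sAt 𝓘(ℝ, E') b' gF e q + c q • gAt 𝓘(ℝ, E') b' gF e q) :
    ∀ e ∈ atlas E' F, ∀ q ∈ e.source, ∀ i j k l : ι', rAt 𝓘(ℝ, E') b' gF e q i j k l =
      (M₁ q + c q * M₄ q + c q ^ 2 * M₆ q)
          * kn (gAt 𝓘(ℝ, E') b' gF e q) (gAt 𝓘(ℝ, E') b' gF e q) i j k l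
        + (M₂ q + a q * M₄ q + c q * M₅ q + 2 * a q * c q * M₆ q)
          * kn (gAt 𝓘(ℝ, E') b' gF e q) (sAt 𝓘(ℝ, E') b' gF e q) i j k l
        + (M₃ q + a q * M₅ q + a q ^ 2 * M₆ q)
          * kn (sAt 𝓘(ℝ, E') b' gF e q) (sAt 𝓘(ℝ, E') b' gF e q) i j k l := by
  intro e he q hq i j k l
  rw [hM e he q hq, kn_of_quadratic (h e he q hq)]

/-- A relation `J S² + J' S + K g = 0` with `J` nowhere zero reduces generalized Roter type to Roter
type. -/
theorem roter_of_relation {M₁ M₂ M₃ M₄ M₅ M₆ K J J' : F → ℝ}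
    (hM : IsScalar 𝓘(ℝ, E') M₁ ∧ IsScalar 𝓘(ℝ, E') M₂ ∧ IsScalar 𝓘(ℝ, E') M₃ ∧
      IsScalar 𝓘(ℝ, E') M₄ ∧ IsScalar 𝓘(ℝ, E') M₅ ∧ IsScalar 𝓘(ℝ, E') M₆)
    (hK : IsScalar 𝓘(ℝ, E') K) (sJ : IsScalar 𝓘(ℝ, E') J) (sJ' : IsScalar 𝓘(ℝ, E') J')
    (hGRT : IsGRTWith 𝓘(ℝ, E') b' gF M₁ M₂ M₃ M₄ M₅ M₆)
    (hrel : ∀ e ∈ atlas E' F, ∀ q ∈ e.source, J q • s2At 𝓘(ℝ, E') b' gF e q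
      + J' q • sAt 𝓘(ℝ, E') b' gF e q + K q • gAt 𝓘(ℝ, E') b' gF e q = 0)
    (hJ : ∀ q, J q ≠ 0) :
    ∃ N₁ N₂ N₃ : F → ℝ,
      (IsScalar 𝓘(ℝ, E') N₁ ∧ IsScalar 𝓘(ℝ, E') N₂ ∧ IsScalar 𝓘(ℝ, E') N₃) ∧
      (∀ e ∈ atlas E' F, ∀ q ∈ e.source, ∀ i j k l : ι', rAt 𝓘(ℝ, E') b' gF e q i j k l =
        N₁ q * kn (gAt 𝓘(ℝ, E') b' gF e q) (gAt 𝓘(ℝ, E') b' gF e q) i j k l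
          + N₂ q * kn (gAt 𝓘(ℝ, E') b' gF e q) (sAt 𝓘(ℝ, E') b' gF e q) i j k l
          + N₃ q * kn (sAt 𝓘(ℝ, E') b' gF e q) (sAt 𝓘(ℝ, E') b' gF e q) i j k l) ∧
      ∀ q, N₃ q = M₃ q + -(J' q * (J q)⁻¹) * M₅ q + (-(J' q * (J q)⁻¹)) ^ 2 * M₆ q := by
  obtain ⟨s₁, s₂, s₃, s₄, s₅, s₆⟩ := hM
  have sJi := sJ.inv hJ
  have sa : IsScalar 𝓘(ℝ, E') fun q => -(J' q * (J q)⁻¹) := (sJ'.mul sJi).neg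
  have sc : IsScalar 𝓘(ℝ, E') fun q => -(K q * (J q)⁻¹) := (hK.mul sJi).neg
  have hquad : ∀ e ∈ atlas E' F, ∀ q ∈ e.source, s2At 𝓘(ℝ, E') b' gF e q
      = (fun q => -(J' q * (J q)⁻¹)) q • sAt 𝓘(ℝ, E') b' gF e q
        + (fun q => -(K q * (J q)⁻¹)) q • gAt 𝓘(ℝ, E') b' gF e q := by
    intro e he q hq
    have h := congrArg ((J q)⁻¹ • ·) (hrel e he q hq)
    simp only [smul_add, smul_smul, inv_mul_cancel₀ (hJ q), one_smul, smul_zero] at h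
    rw [add_assoc, add_eq_zero_iff_eq_neg] at h
    rw [h]
    module
  exact ⟨_, _, _, ⟨(s₁.add (sc.mul s₄)).add ((sc.pow 2).mul s₆),
    ((s₂.add (sa.mul s₄)).add (sc.mul s₅)).add ((((IsScalar.const 2).mul sa).mul sc).mul s₆),
    -- The coefficient of `S∧S` is returned explicitly, because its vanishing is what conformal
    -- flatness requires.
    (s₃.add (sa.mul s₅)).add ((sa.pow 2).mul s₆)⟩, hGRT.reduce hquad, fun _ => rfl⟩

end Reduction

/-! ### Transfer from product charts to base and fiber -/

section Main

variable {ι E B : Type*} [Fintype ι] [DecidableEq ι] [NormedAddCommGroup E] [NormedSpace ℝ E]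
  [TopologicalSpace B] [ChartedSpace E B] [IsManifold 𝓘(ℝ, E) ∞ B]
  {ι' E' F : Type*} [Fintype ι'] [DecidableEq ι'] [NormedAddCommGroup E'] [NormedSpace ℝ E']
  [TopologicalSpace F] [ChartedSpace E' F] [IsManifold 𝓘(ℝ, E') ∞ F]
  {b : Basis ι ℝ E} {b' : Basis ι' ℝ E'}
  {gB : FormField 𝓘(ℝ, E) B} {gF : FormField 𝓘(ℝ, E') F} {f : B → ℝ}
  {L₁ L₂ L₃ L₄ L₅ L₆ : B × F → ℝ}
  {e : OpenPartialHomeomorph B E} {e' : OpenPartialHomeomorph F E'}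

theorem isWarpedOn (hgB : IsSemiRiemannian 𝓘(ℝ, E) b gB) (hgF : IsSemiRiemannian 𝓘(ℝ, E') b' gF)
    (hf : IsScalar 𝓘(ℝ, E) f) (hf_pos : ∀ x, 0 < f x) (he : e ∈ atlas E B)
    (he' : e' ∈ atlas E' F) :
    IsWarpedOn (metricCoord 𝓘(ℝ, E) b gB e) (e.extend 𝓘(ℝ, E)).target
      (metricCoord 𝓘(ℝ, E') b' gF e') (e'.extend 𝓘(ℝ, E')).target
      (f ∘ (e.extend 𝓘(ℝ, E)).symm) where
  base := hgB.isMetricOn he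
  fiber := hgF.isMetricOn he'
  smooth := contDiffOn_comp_extend_symm he hf
  ne_zero _ _ := (hf_pos _).ne'

theorem IsGRTWith.isGRTAt_prod
    (hR : IsGRTWith (𝓘(ℝ, E).prod 𝓘(ℝ, E')) (b.prod b')
      (warpedMetric 𝓘(ℝ, E) 𝓘(ℝ, E') gB gF f) L₁ L₂ L₃ L₄ L₅ L₆)
    (he : e ∈ atlas E B) (he' : e' ∈ atlas E' F) {x : B} {y : F} (hx : x ∈ e.source)
    (hy : y ∈ e'.source) :
    IsGRTAt (b.prod b') (blockMetric (metricCoord 𝓘(ℝ, E) b gB e)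
        (metricCoord 𝓘(ℝ, E') b' gF e') (f ∘ (e.extend 𝓘(ℝ, E)).symm))
      (e.extend 𝓘(ℝ, E) x, e'.extend 𝓘(ℝ, E') y)
      (L₁ (x, y)) (L₂ (x, y)) (L₃ (x, y)) (L₄ (x, y)) (L₅ (x, y)) (L₆ (x, y)) := by
  have hz := extend_prod_mem_target (E := E) (E' := E') hx hy
  have hev : metricCoord (𝓘(ℝ, E).prod 𝓘(ℝ, E')) (b.prod b')
      (warpedMetric 𝓘(ℝ, E) 𝓘(ℝ, E') gB gF f) (e.prod e')
      =ᶠ[nhds (e.extend 𝓘(ℝ, E) x, e'.extend 𝓘(ℝ, E') y)]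
      blockMetric (metricCoord 𝓘(ℝ, E) b gB e) (metricCoord 𝓘(ℝ, E') b' gF e')
        (f ∘ (e.extend 𝓘(ℝ, E)).symm) :=
    Filter.eventuallyEq_of_mem
      (((isOpen_extend_target e).prod (isOpen_extend_target e')).mem_nhds hz)
      fun w hw => metricCoord_warpedMetric b b' gB gF f he he' hw
  intro i j k l
  rw [← riem_congr _ hev, ← ricci_congr _ hev, ← hev.eq_of_nhds]
  -- Products of charts belong to the atlas of the product, so the hypothesis on all charts applies
  -- to them.
  exact hR (e.prod e') (Set.mem_image2_of_mem he he') (x, y) ⟨hx, hy⟩ i j k l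

/-- The structure of the fiber of a warped product of generalized Roter type: the fiber is of
generalized Roter type, and `J₁ S² + J₂ S` is proportional to the metric. -/
theorem fiber_structure (hgB : IsSemiRiemannian 𝓘(ℝ, E) b gB)
    (hgF : IsSemiRiemannian 𝓘(ℝ, E') b' gF) (hf : IsScalar 𝓘(ℝ, E) f) (hf_pos : ∀ x, 0 < f x)
    (h₁ : IsScalar (𝓘(ℝ, E).prod 𝓘(ℝ, E')) L₁) (h₂ : IsScalar (𝓘(ℝ, E).prod 𝓘(ℝ, E')) L₂)
    (h₃ : IsScalar (𝓘(ℝ, E).prod 𝓘(ℝ, E')) L₃) (h₄ : IsScalar (𝓘(ℝ, E).prod 𝓘(ℝ, E')) L₄)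
    (h₅ : IsScalar (𝓘(ℝ, E).prod 𝓘(ℝ, E')) L₅) (h₆ : IsScalar (𝓘(ℝ, E).prod 𝓘(ℝ, E')) L₆)
    (hR : IsGRTWith (𝓘(ℝ, E).prod 𝓘(ℝ, E')) (b.prod b')
      (warpedMetric 𝓘(ℝ, E) 𝓘(ℝ, E') gB gF f) L₁ L₂ L₃ L₄ L₅ L₆) (x : B) :
    ∃ M₁ M₂ M₃ M₄ M₅ M₆ K : F → ℝ,
      (IsScalar 𝓘(ℝ, E') M₁ ∧ IsScalar 𝓘(ℝ, E') M₂ ∧ IsScalar 𝓘(ℝ, E') M₃ ∧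
        IsScalar 𝓘(ℝ, E') M₄ ∧ IsScalar 𝓘(ℝ, E') M₅ ∧ IsScalar 𝓘(ℝ, E') M₆) ∧
      IsScalar 𝓘(ℝ, E') K ∧
      IsScalar 𝓘(ℝ, E') (fun y => J1 𝓘(ℝ, E) b gB f (Fintype.card ι') L₄ L₅ L₆ (x, y)) ∧
      IsScalar 𝓘(ℝ, E') (fun y => J2 𝓘(ℝ, E) b gB f (Fintype.card ι') L₂ L₃ L₄ L₅ L₆ (x, y)) ∧
      IsGRTWith 𝓘(ℝ, E') b' gF M₁ M₂ M₃ M₄ M₅ M₆ ∧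
      (∀ e' ∈ atlas E' F, ∀ y ∈ e'.source,
        J1 𝓘(ℝ, E) b gB f (Fintype.card ι') L₄ L₅ L₆ (x, y) • s2At 𝓘(ℝ, E') b' gF e' y
          + J2 𝓘(ℝ, E) b gB f (Fintype.card ι') L₂ L₃ L₄ L₅ L₆ (x, y) • sAt 𝓘(ℝ, E') b' gF e' y
          + K y • gAt 𝓘(ℝ, E') b' gF e' y = 0) ∧
      ∀ y, f x * M₃ y = L₃ (x, y)
            + 2 * scalarQ 𝓘(ℝ, E) b gB f (Fintype.card ι') x * ((f x)⁻¹ * L₅ (x, y))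
            + 4 * scalarQ 𝓘(ℝ, E) b gB f (Fintype.card ι') x ^ 2 * ((f x)⁻¹ ^ 2 * L₆ (x, y)) ∧
          f x * M₅ y = (f x)⁻¹ * L₅ (x, y)
            + 4 * scalarQ 𝓘(ℝ, E) b gB f (Fintype.card ι') x * ((f x)⁻¹ ^ 2 * L₆ (x, y)) ∧
          f x * M₆ y = (f x)⁻¹ ^ 2 * L₆ (x, y) := by
  -- The base scalars are defined through the preferred chart at `x`. Using the same chart makes
  -- them agree by unfolding with the coordinate expressions, while the fiber chart stays arbitrary.
  set e := chartAt E x with he_def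
  have he : e ∈ atlas E B := chart_mem_atlas E x
  have hx : x ∈ e.source := mem_chart_source E x
  have hxe : (e.extend 𝓘(ℝ, E)).symm (e.extend 𝓘(ℝ, E) x) = x := e.extend_left_inv hx
  have hfx := (hf_pos x).ne'
  set φ := f x with hφ
  have hφ' : φ = (f ∘ (e.extend 𝓘(ℝ, E)).symm) (e.extend 𝓘(ℝ, E) x) := by
    rw [Function.comp_apply, hxe]
  set Q := scalarQ 𝓘(ℝ, E) b gB f (Fintype.card ι') x with hQ
  have hQ' : Q = coordQ b (metricCoord 𝓘(ℝ, E) b gB e) (f ∘ (e.extend 𝓘(ℝ, E)).symm)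
      (Fintype.card ι') (e.extend 𝓘(ℝ, E) x) := by
    rw [coordQ, ← hφ']; rfl
  set P := pAt 𝓘(ℝ, E) b gB f e x with hP
  set τ := trT 𝓘(ℝ, E) b gB f x with hτ
  set ρ := rBase 𝓘(ℝ, E) b gB x + (Fintype.card ι' : ℝ) * τ with hρ
  set Θ := bracketBase 𝓘(ℝ, E) b gB f (Fintype.card ι') x with hΘ
  have hJ1 : ∀ y, J1 𝓘(ℝ, E) b gB f (Fintype.card ι') L₄ L₅ L₆ (x, y)
      = -(φ⁻¹ * (L₄ (x, y) * Fintype.card ι + L₅ (x, y) * ρ + 2 * L₆ (x, y) * Θ)) := by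
    intro y
    simp only [J1, ← hφ, ← hτ, ← hΘ, hρ]
    ring
  have hJ2 : ∀ y, J2 𝓘(ℝ, E) b gB f (Fintype.card ι') L₂ L₃ L₄ L₅ L₆ (x, y)
      = -(L₂ (x, y) * Fintype.card ι + 2 * L₃ (x, y) * ρ + L₅ (x, y) * Θ
        + 2 * Q * φ⁻¹ * (L₄ (x, y) * Fintype.card ι + L₅ (x, y) * ρ + 2 * L₆ (x, y) * Θ)) := by
    intro y
    simp only [J2, ← hφ, ← hτ, ← hΘ, ← hQ, hρ]
    field_simp
    ring
  have s₁ := h₁.section_right x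
  have s₂ := h₂.section_right x
  have s₃ := h₃.section_right x
  have s₄ := h₄.section_right x
  have s₅ := h₅.section_right x
  have s₆ := h₆.section_right x
  refine ⟨fun y => φ⁻¹ * (φ ^ 2 * (L₁ (x, y) + 1 / 2 * P) + Q * (φ * L₂ (x, y))
      + Q ^ 2 * L₃ (x, y) + Q ^ 2 * L₄ (x, y)
        + Q ^ 3 * (φ⁻¹ * L₅ (x, y)) + Q ^ 4 * (φ⁻¹ ^ 2 * L₆ (x, y))),
    fun y => φ⁻¹ * (φ * L₂ (x, y) + 2 * Q * L₃ (x, y) + 2 * Q * L₄ (x, y)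
        + 3 * Q ^ 2 * (φ⁻¹ * L₅ (x, y)) + 4 * Q ^ 3 * (φ⁻¹ ^ 2 * L₆ (x, y))),
    fun y => φ⁻¹ * (L₃ (x, y) + 2 * Q * (φ⁻¹ * L₅ (x, y)) + 4 * Q ^ 2 * (φ⁻¹ ^ 2 * L₆ (x, y))),
    fun y => φ⁻¹ * (L₄ (x, y) + Q * (φ⁻¹ * L₅ (x, y)) + 2 * Q ^ 2 * (φ⁻¹ ^ 2 * L₆ (x, y))),
    fun y => φ⁻¹ * (φ⁻¹ * L₅ (x, y) + 4 * Q * (φ⁻¹ ^ 2 * L₆ (x, y))),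
    fun y => φ⁻¹ * (φ⁻¹ ^ 2 * L₆ (x, y)),
    -- This witness is `K`, the negative of the coefficient of `g̃` in `fiber_relation`, in keeping
    -- with the signs of `J₁` and `J₂`.
    fun y => -(2 * L₁ (x, y) * Fintype.card ι * φ + L₂ (x, y) * (Fintype.card ι * Q + ρ * φ)
          + 2 * L₃ (x, y) * ρ * Q + L₄ (x, y) * Θ * φ + L₅ (x, y) * Θ * Q
          + Q ^ 2 * φ⁻¹ * (L₄ (x, y) * Fintype.card ι + L₅ (x, y) * ρ + 2 * L₆ (x, y) * Θ)
          - φ * τ), ⟨?_, ?_, ?_, ?_, ?_, ?_⟩, ?_, ?_, ?_, ?_, ?_, ?_⟩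
  any_goals
    try simp only [hJ1, hJ2]
    repeat' first
      | assumption
      | exact IsScalar.const _
      | apply IsScalar.add
      | apply IsScalar.sub
      | apply IsScalar.neg
      | apply IsScalar.mul
  · intro e' he' y hy
    have H := isWarpedOn hgB hgF hf hf_pos he he'
    exact H.isGRTAt_fiber b b' (extend_prod_mem_target hx hy) (hR.isGRTAt_prod he he' hx hy)
      hφ' rfl hQ'
  · intro e' he' y hy
    have H := isWarpedOn hgB hgF hf hf_pos he he'
    have := H.fiber_relation b b' (extend_prod_mem_target hx hy)
      (hR.isGRTAt_prod he he' hx hy) hφ' hQ' (τ := τ) (ρ := ρ) (Θ := Θ) rfl rfl rfl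
    rw [← neg_eq_zero, ← this]
    simp only [s2At, sAt, gAt]
    module
  · intro y
    simp only [mul_inv_cancel_left₀ hfx, and_self]

/-- A linear dependence of `T`, `g` and `S` on the base forces the base to be of generalized Roter
type. -/
theorem base_isGRT [Nonempty F] (hgB : IsSemiRiemannian 𝓘(ℝ, E) b gB)
    (hgF : IsSemiRiemannian 𝓘(ℝ, E') b' gF) (hf : IsScalar 𝓘(ℝ, E) f) (hf_pos : ∀ x, 0 < f x)
    (h₁ : IsScalar (𝓘(ℝ, E).prod 𝓘(ℝ, E')) L₁) (h₂ : IsScalar (𝓘(ℝ, E).prod 𝓘(ℝ, E')) L₂)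
    (h₃ : IsScalar (𝓘(ℝ, E).prod 𝓘(ℝ, E')) L₃) (h₄ : IsScalar (𝓘(ℝ, E).prod 𝓘(ℝ, E')) L₄)
    (h₅ : IsScalar (𝓘(ℝ, E).prod 𝓘(ℝ, E')) L₅) (h₆ : IsScalar (𝓘(ℝ, E).prod 𝓘(ℝ, E')) L₆)
    (hR : IsGRTWith (𝓘(ℝ, E).prod 𝓘(ℝ, E')) (b.prod b')
      (warpedMetric 𝓘(ℝ, E) 𝓘(ℝ, E') gB gF f) L₁ L₂ L₃ L₄ L₅ L₆)
    (hT : DependentT 𝓘(ℝ, E) b gB f) : IsGRT 𝓘(ℝ, E) b gB := by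
  obtain ⟨y⟩ := ‹Nonempty F›
  obtain ⟨α, β, γ, ⟨hα, hβ, hγ⟩, hα0, hdep⟩ := hT
  set m : ℝ := (Fintype.card ι' : ℝ)
  -- Solving the dependence gives `T = -(β ḡ + γ S̄)/α`, so `S̄ + m T = u S̄ + v ḡ`. A single fiber
  -- point `y` suffices to restrict the `Lᵢ` to the base.
  set u : B → ℝ := fun x => 1 - m * (γ x * (α x)⁻¹) with hu
  set v : B → ℝ := fun x => -(m * (β x * (α x)⁻¹)) with hv
  have hαi := hα.inv hα0
  have su : IsScalar 𝓘(ℝ, E) u := (IsScalar.const 1).sub ((IsScalar.const m).mul (hγ.mul hαi))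
  have sv : IsScalar 𝓘(ℝ, E) v := ((IsScalar.const m).mul (hβ.mul hαi)).neg
  have s₁ := h₁.section_left y
  have s₂ := h₂.section_left y
  have s₃ := h₃.section_left y
  have s₄ := h₄.section_left y
  have s₅ := h₅.section_left y
  have s₆ := h₆.section_left y
  refine ⟨fun x => L₁ (x, y) + v x * L₂ (x, y) + v x ^ 2 * L₃ (x, y) + v x ^ 2 * L₄ (x, y)
      + v x ^ 3 * L₅ (x, y) + v x ^ 4 * L₆ (x, y),
    fun x => u x * L₂ (x, y) + 2 * u x * v x * L₃ (x, y) + 2 * u x * v x * L₄ (x, y)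
      + 3 * u x * v x ^ 2 * L₅ (x, y) + 4 * u x * v x ^ 3 * L₆ (x, y),
    fun x => u x ^ 2 * L₃ (x, y) + 2 * u x ^ 2 * v x * L₅ (x, y)
      + 4 * u x ^ 2 * v x ^ 2 * L₆ (x, y),
    fun x => u x ^ 2 * L₄ (x, y) + u x ^ 2 * v x * L₅ (x, y) + 2 * u x ^ 2 * v x ^ 2 * L₆ (x, y),
    fun x => u x ^ 3 * L₅ (x, y) + 4 * u x ^ 3 * v x * L₆ (x, y),
    fun x => u x ^ 4 * L₆ (x, y), ⟨?_, ?_, ?_, ?_, ?_, ?_⟩, ?_⟩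
  any_goals
    repeat' first
      | assumption
      | exact IsScalar.const _
      | apply IsScalar.add
      | apply IsScalar.mul
      | apply IsScalar.pow
  intro e he x hx
  have he' : chartAt E' y ∈ atlas E' F := chart_mem_atlas E' y
  have H := isWarpedOn hgB hgF hf hf_pos he he'
  refine H.isGRTAt_base b b' (extend_prod_mem_target hx (mem_chart_source E' y))
    (hR.isGRTAt_prod he he' hx (mem_chart_source E' y)) ?_
  have h := hdep e he x hx
  change sAt 𝓘(ℝ, E) b gB e x + m • tAt 𝓘(ℝ, E) b gB f e x
    = u x • sAt 𝓘(ℝ, E) b gB e x + v x • gAt 𝓘(ℝ, E) b gB e x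
  ext i j
  have hij := congrFun (congrFun h i) j
  simp only [Matrix.add_apply, Matrix.smul_apply, smul_eq_mul, Matrix.zero_apply] at hij ⊢
  simp only [hu, hv]
  have := hα0 x
  field_simp
  linear_combination m * hij

theorem IsConformallyFlat.weylVanishes (hgF : IsSemiRiemannian 𝓘(ℝ, E') b' gF)
    (hι : 3 ≤ Fintype.card ι') (h : IsConformallyFlat 𝓘(ℝ, E') b' gF) :
    WeylVanishes 𝓘(ℝ, E') b' gF := by
  obtain ⟨N₁, N₂, -, hN⟩ := h
  intro e he q hq i j k l
  have hm := hgF.isMetricOn he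
  have hz : e.extend 𝓘(ℝ, E') q ∈ (e.extend 𝓘(ℝ, E')).target :=
    (e.extend 𝓘(ℝ, E')).map_source (by simpa using hq)
  exact weyl_eq_zero (hm.isUnit _ hz) (hm.symm _ hz) hι (fun _ _ => rfl) (hN e he q hq) i j k l

theorem isEinstein_of_proportional (hgF : IsSemiRiemannian 𝓘(ℝ, E') b' gF) [Nonempty ι']
    {lam : F → ℝ} (h : ∀ e ∈ atlas E' F, ∀ q ∈ e.source,
      sAt 𝓘(ℝ, E') b' gF e q = lam q • gAt 𝓘(ℝ, E') b' gF e q) :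
    IsEinstein 𝓘(ℝ, E') b' gF := by
  intro e he q hq
  have hm := hgF.isMetricOn he
  have hz : e.extend 𝓘(ℝ, E') q ∈ (e.extend 𝓘(ℝ, E')).target :=
    (e.extend 𝓘(ℝ, E')).map_source (by simpa using hq)
  have hκ : scalAt 𝓘(ℝ, E') b' gF e q = lam q * Fintype.card ι' := by
    rw [scalAt, h e he q hq, tr_smul, gAt, tr_self (hm.isUnit _ hz) (hm.symm _ hz)]
  have hc : (Fintype.card ι' : ℝ) ≠ 0 := Nat.cast_ne_zero.2 Fintype.card_ne_zero
  rw [hκ, mul_div_cancel_right₀ _ hc, h e he q hq]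

/-- A relation `J' S + K g = 0` with `J'` nowhere zero reduces generalized Roter type to pointwise
constant curvature. -/
theorem constant_curvature_of_relation [Nonempty ι'] (hgF : IsSemiRiemannian 𝓘(ℝ, E') b' gF)
    {M₁ M₂ M₃ M₄ M₅ M₆ K J J' : F → ℝ}
    (hM : IsScalar 𝓘(ℝ, E') M₁ ∧ IsScalar 𝓘(ℝ, E') M₂ ∧ IsScalar 𝓘(ℝ, E') M₃ ∧
      IsScalar 𝓘(ℝ, E') M₄ ∧ IsScalar 𝓘(ℝ, E') M₅ ∧ IsScalar 𝓘(ℝ, E') M₆)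
    (hK : IsScalar 𝓘(ℝ, E') K) (sJ' : IsScalar 𝓘(ℝ, E') J')
    (hGRT : IsGRTWith 𝓘(ℝ, E') b' gF M₁ M₂ M₃ M₄ M₅ M₆)
    (hrel : ∀ e ∈ atlas E' F, ∀ q ∈ e.source, J q • s2At 𝓘(ℝ, E') b' gF e q
      + J' q • sAt 𝓘(ℝ, E') b' gF e q + K q • gAt 𝓘(ℝ, E') b' gF e q = 0)
    (hJ : ∀ q, J q = 0) (hJ' : ∀ q, J' q ≠ 0) :
    HasPointwiseConstantCurvature 𝓘(ℝ, E') b' gF ∧ IsEinstein 𝓘(ℝ, E') b' gF := by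
  obtain ⟨s₁, s₂, s₃, s₄, s₅, s₆⟩ := hM
  have sl : IsScalar 𝓘(ℝ, E') fun q => -(K q * (J' q)⁻¹) := (hK.mul (sJ'.inv hJ')).neg
  have hprop : ∀ e ∈ atlas E' F, ∀ q ∈ e.source, sAt 𝓘(ℝ, E') b' gF e q
      = (fun q => -(K q * (J' q)⁻¹)) q • gAt 𝓘(ℝ, E') b' gF e q := by
    intro e he q hq
    have h := congrArg ((J' q)⁻¹ • ·) (hrel e he q hq)
    simp only [hJ q, zero_smul, zero_add, smul_add, smul_smul, inv_mul_cancel₀ (hJ' q), one_smul,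
      smul_zero] at h
    rw [add_eq_zero_iff_eq_neg] at h
    rw [h]
    module
  refine ⟨?_, isEinstein_of_proportional hgF hprop⟩
  set c : F → ℝ := fun q => -(K q * (J' q)⁻¹)
  refine ⟨fun q => 2 * (M₁ q + c q * M₂ q + c q ^ 2 * M₃ q + c q ^ 2 * M₄ q + c q ^ 3 * M₅ q
    + c q ^ 4 * M₆ q), (IsScalar.const 2).mul (((((s₁.add (sl.mul s₂)).add ((sl.pow 2).mul s₃)).add
      ((sl.pow 2).mul s₄)).add ((sl.pow 3).mul s₅)).add ((sl.pow 4).mul s₆)), ?_⟩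
  intro e he q hq i j k l
  have hm := hgF.isMetricOn he
  have hz : e.extend 𝓘(ℝ, E') q ∈ (e.extend 𝓘(ℝ, E')).target :=
    (e.extend 𝓘(ℝ, E')).map_source (by simpa using hq)
  -- Since `S = c g`, this is the case `u = 0`, `v = c` of the binomial square. Every product in the
  -- Roter form is then a multiple of `g∧g`.
  have hs2 : s2At 𝓘(ℝ, E') b' gF e q = c q ^ 2 • gAt 𝓘(ℝ, E') b' gF e q := by
    have := comp_affine (G := gAt 𝓘(ℝ, E') b' gF e q) (hm.isUnit _ hz) 0 0 (c q)
    simpa [s2At, hprop e he q hq] using this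
  rw [hGRT e he q hq, hs2, hprop e he q hq]
  simp only [kn, Matrix.smul_apply, smul_eq_mul, c]
  ring

end Main

end WarpedGRT

end

/-! ### The five assertions -/

theorem corollary5p1
    (p m : ℕ) (hp : 1 ≤ p) (hm : 1 ≤ m)
    {B F : Type*}
    [TopologicalSpace B] [ChartedSpace (EuclideanSpace ℝ (Fin p)) B]
    [IsManifold 𝓘(ℝ, EuclideanSpace ℝ (Fin p)) ∞ B] [ConnectedSpace B]
    [TopologicalSpace F] [ChartedSpace (EuclideanSpace ℝ (Fin m)) F]
    [IsManifold 𝓘(ℝ, EuclideanSpace ℝ (Fin m)) ∞ F] [ConnectedSpace F]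
    (gB : WarpedGRT.FormField 𝓘(ℝ, EuclideanSpace ℝ (Fin p)) B)
    (hgB : WarpedGRT.IsSemiRiemannian _ (WarpedGRT.stdBasis p) gB)
    (gF : WarpedGRT.FormField 𝓘(ℝ, EuclideanSpace ℝ (Fin m)) F)
    (hgF : WarpedGRT.IsSemiRiemannian _ (WarpedGRT.stdBasis m) gF)
    (f : B → ℝ) (hf : WarpedGRT.IsScalar 𝓘(ℝ, EuclideanSpace ℝ (Fin p)) f)
    (hf_pos : ∀ x, 0 < f x)
    (L₁ L₂ L₃ L₄ L₅ L₆ : B × F → ℝ)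
    (hL : ∀ L ∈ [L₁, L₂, L₃, L₄, L₅, L₆], WarpedGRT.IsScalar
      (𝓘(ℝ, EuclideanSpace ℝ (Fin p)).prod 𝓘(ℝ, EuclideanSpace ℝ (Fin m))) L)
    (hR : WarpedGRT.IsGRTWith _ ((WarpedGRT.stdBasis p).prod (WarpedGRT.stdBasis m))
      (WarpedGRT.warpedMetric _ _ gB gF f) L₁ L₂ L₃ L₄ L₅ L₆)
    (J₁ J₂ : B × F → ℝ) (Q : B → ℝ)
    (hJ₁ : J₁ = WarpedGRT.J1 _ (WarpedGRT.stdBasis p) gB f m L₄ L₅ L₆)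
    (hJ₂ : J₂ = WarpedGRT.J2 _ (WarpedGRT.stdBasis p) gB f m L₂ L₃ L₄ L₅ L₆)
    (hQ : Q = WarpedGRT.scalarQ _ (WarpedGRT.stdBasis p) gB f m) :
    -- the fiber is of generalized Roter type
    WarpedGRT.IsGRT _ (WarpedGRT.stdBasis m) gF ∧
    -- the fiber is of Roter type and satisfies the second Einstein-type condition
    (∀ x : B, (∀ y : F, J₁ (x, y) ≠ 0) →
      WarpedGRT.IsRoter _ (WarpedGRT.stdBasis m) gF ∧
      WarpedGRT.IsEin2 _ (WarpedGRT.stdBasis m) gF) ∧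
    -- the fiber is conformally flat
    (∀ x : B, (∀ y : F, J₁ (x, y) ≠ 0 ∧
        J₂ (x, y) ^ 2 * L₆ (x, y) / (f x ^ 2 * J₁ (x, y) ^ 2)
          - J₂ (x, y) * (f x * L₅ (x, y) + 4 * L₆ (x, y) * Q x) / (f x ^ 2 * J₁ (x, y))
          + 2 * Q x * (f x * L₅ (x, y) + 2 * L₆ (x, y) * Q x) / f x ^ 2
          + L₃ (x, y) = 0) →
      WarpedGRT.IsConformallyFlat _ (WarpedGRT.stdBasis m) gF ∧
      (3 ≤ m → WarpedGRT.WeylVanishes _ (WarpedGRT.stdBasis m) gF)) ∧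
    -- the fiber is of constant curvature and Einstein
    (∀ x : B, (∀ y : F, J₁ (x, y) = 0 ∧ J₂ (x, y) ≠ 0) →
      WarpedGRT.HasPointwiseConstantCurvature _ (WarpedGRT.stdBasis m) gF ∧
      (m ≠ 2 → WarpedGRT.HasConstantCurvature _ (WarpedGRT.stdBasis m) gF) ∧
      WarpedGRT.IsEinstein _ (WarpedGRT.stdBasis m) gF) ∧
    -- the base is of generalized Roter type
    (WarpedGRT.DependentT _ (WarpedGRT.stdBasis p) gB f →
      WarpedGRT.IsGRT _ (WarpedGRT.stdBasis p) gB) := by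
  obtain ⟨x₀⟩ : Nonempty B := inferInstance
  have : Nonempty F := inferInstance
  have : Nonempty (Fin m) := ⟨⟨0, hm⟩⟩
  simp only [List.mem_cons, List.not_mem_nil, or_false, forall_eq_or_imp, forall_eq] at hL
  obtain ⟨h₁, h₂, h₃, h₄, h₅, h₆⟩ := hL
  have fiber := WarpedGRT.fiber_structure hgB hgF hf hf_pos h₁ h₂ h₃ h₄ h₅ h₆ hR
  rw [Fintype.card_fin, ← hJ₁, ← hJ₂, ← hQ] at fiber
  refine ⟨?_, ?_, ?_, ?_, ?_⟩
  · obtain ⟨M₁, M₂, M₃, M₄, M₅, M₆, -, hM, -, -, -, hGRT, -⟩ := fiber x₀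
    exact ⟨M₁, M₂, M₃, M₄, M₅, M₆, hM, hGRT⟩
  · intro x hJ
    obtain ⟨M₁, M₂, M₃, M₄, M₅, M₆, K, hM, hK, sJ₁, sJ₂, hGRT, hrel, -⟩ := fiber x
    obtain ⟨N₁, N₂, N₃, hN, hR', -⟩ :=
      WarpedGRT.roter_of_relation hM hK sJ₁ sJ₂ hGRT hrel hJ
    -- The relation of `fiber_structure` is itself the `Ein(2)` condition; its leading coefficient
    -- `J₁` has no zero.
    exact ⟨⟨N₁, N₂, N₃, hN, hR'⟩, _, _, K, ⟨sJ₁, sJ₂, hK⟩, fun y => Or.inl (hJ y), hrel⟩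
  · intro x hJ
    obtain ⟨M₁, M₂, M₃, M₄, M₅, M₆, K, hM, hK, sJ₁, sJ₂, hGRT, hrel, hcoeff⟩ := fiber x
    obtain ⟨N₁, N₂, N₃, hN, hR', hN₃⟩ :=
      WarpedGRT.roter_of_relation hM hK sJ₁ sJ₂ hGRT hrel fun y => (hJ y).1
    -- Here `N₃ = M₃ + a M₅ + a² M₆` with `a = -J₂/J₁`. Multiplied by `f`, it is exactly the
    -- expression assumed to vanish.
    have hzero : ∀ y, N₃ y = 0 := by
      intro y
      obtain ⟨hJ0, hJe⟩ := hJ y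
      obtain ⟨c₃, c₅, c₆⟩ := hcoeff y
      have hfx := (hf_pos x).ne'
      refine (mul_eq_zero.1 ?_).resolve_left hfx
      rw [← hJe, hN₃ y]
      have : f x * (M₃ y + -(J₂ (x, y) * (J₁ (x, y))⁻¹) * M₅ y
            + (-(J₂ (x, y) * (J₁ (x, y))⁻¹)) ^ 2 * M₆ y)
          = f x * M₃ y - J₂ (x, y) * (J₁ (x, y))⁻¹ * (f x * M₅ y)
            + (J₂ (x, y) * (J₁ (x, y))⁻¹) ^ 2 * (f x * M₆ y) := by ring
      rw [this, c₃, c₅, c₆]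
      field_simp
      ring
    have hflat : WarpedGRT.IsConformallyFlat 𝓘(ℝ, EuclideanSpace ℝ (Fin m))
        (WarpedGRT.stdBasis m) gF := by
      refine ⟨N₁, N₂, ⟨hN.1, hN.2.1⟩, fun e he q hq i j k l => ?_⟩
      rw [hR' e he q hq, hzero, zero_mul, add_zero]
    exact ⟨hflat, fun h3 => hflat.weylVanishes hgF (by simpa using h3)⟩
  · intro x hJ
    obtain ⟨M₁, M₂, M₃, M₄, M₅, M₆, K, hM, hK, sJ₁, sJ₂, hGRT, hrel, -⟩ := fiber x
    obtain ⟨hpc, hE⟩ := WarpedGRT.constant_curvature_of_relation hgF hM hK sJ₂ hGRT hrel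
      (fun y => (hJ y).1) fun y => (hJ y).2
    refine ⟨hpc, fun hm2 => ?_, hE⟩
    -- Schur's lemma needs `m ≥ 3`. For `m = 1` the curvature vanishes, and `m = 2` is excluded by
    -- hypothesis.
    rcases (by omega : m = 1 ∨ 3 ≤ m) with rfl | h3
    · exact WarpedGRT.hasConstantCurvature_of_subsingleton hpc
    · exact hpc.hasConstantCurvature hgF (by simpa using h3)
  · exact WarpedGRT.base_isGRT hgB hgF hf hf_pos h₁ h₂ h₃ h₄ h₅ h₆ hR
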